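/- A rooted labeled tree on $n\ge 1$ vertices consists of a root among $n$ labeled vertices and, for every other vertex, an immediate supervisor (parent), such that the chain of parents starting at any vertex leads to the root. The height of a vertex is its distance to the root, and the total height of a tree is the sum of the heights of all its vertices. Let $X_n$ be the total height of a uniformly random rooted labeled tree on $n$ vertices, and put $$W_n=\frac{n!}{n^{n-1}}\sum_{k=0}^{n-2}\frac{n^k}{k!}.$$ **Theorem 3.** (i) For every $n\ge1$, the third moment of $X_n$ about its mean is $$E[(X_n-E X_n)^3]=2W_n^3+\tfrac{17}{2}nW_n^2+\left(-\tfrac{25}{8}n^3+\tfrac{277}{24}n^2-\tfrac{1}{60}n\right)W_n-\tfrac{151}{30}n^4+\tfrac{76}{15}n^3-\tfrac1{30}n^2 .$$ (ii) As $n\to\infty$, $$E[(X_n-E X_n)^3]\sim\left(\tfrac12\sqrt2\,\pi^{3/2}-\tfrac{25}{16}\sqrt2\sqrt\pi\right)n^{9/2},$$ where the constant differs from $0.020795808$ by less than $10^{-9}$. (iii) As $n\to\infty$, the skewness $E[(X_n-EX_n)^3]/(\operatorname{Var}X_n)^{3/2}$ tends to $$\frac{\left(6\pi-\frac{75}{4}\right)\sqrt3\,\sqrt{\frac{\pi}{10-3\pi}}}{10-3\pi},$$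 a number that differs from $0.7005665$ by less than $5\cdot10^{-8}$. (iv) Consequently the limit distribution, whatever it is, is not normal: the standardized total height $(X_n-EX_n)/\sqrt{\operatorname{Var}X_n}$ does not converge in distribution to a normal law (of any mean and any variance, degenerate ones included), not even along a subsequence of the $n$'s. -/

import Mathlib

open MeasureTheory ProbabilityTheory Filter Topology Asymptotics

/-- A rooted labeled tree on the vertex set `Fin n`: a distinguished vertex (the root), and an
immediate supervisor `parent v` for every other vertex `v`, such that the chain of supervisors of
every vertex leads to the root (equivalently, no vertex other than the root is its own immediate or
indirect supervisor). The value of `parent` at the root carries no information; it is normalized to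
be the root itself, so that each tree is represented exactly once. -/
@[ext]
structure RootedLabeledTree (n : ℕ) where
  root : Fin n
  parent : Fin n → Fin n
  parent_root : parent root = root
  reaches_root : ∀ v, ∃ k : ℕ, parent^[k] v = root

namespace RootedLabeledTree

/-- The height of a vertex: its distance to the root, that is, the number of steps after which the
chain of supervisors of `v` first reaches the root. -/
def height {n : ℕ} (T : RootedLabeledTree n) (v : Fin n) : ℕ :=
  Nat.find (T.reaches_root v)

/-- The total height of a tree: the sum of the heights of all vertices. -/
def totalHeight {n : ℕ} (T : RootedLabeledTree n) : ℕ :=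
  ∑ v, T.height v

instance (n : ℕ) : Finite (RootedLabeledTree n) :=
  Finite.of_injective (fun T : RootedLabeledTree n => (T.root, T.parent)) fun S T h => by
    simp only [Prod.mk.injEq] at h
    exact RootedLabeledTree.ext h.1 h.2

/-- The star centred at `0`; there is a tree on every nonempty vertex set. -/
instance (n : ℕ) [NeZero n] : Nonempty (RootedLabeledTree n) :=
  ⟨⟨0, fun _ => 0, rfl, fun _ => ⟨1, rfl⟩⟩⟩

/-- Every set of trees is an event. -/
instance (n : ℕ) : MeasurableSpace (RootedLabeledTree n) := ⊤

instance (n : ℕ) : DiscreteMeasurableSpace (RootedLabeledTree n) := ⟨fun _ => trivial⟩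

/-- The uniform probability measure on the rooted labeled trees on `n` vertices. -/
noncomputable def uniform (n : ℕ) : Measure (RootedLabeledTree n) :=
  uniformOn Set.univ

instance (n : ℕ) [NeZero n] : IsProbabilityMeasure (uniform n) :=
  isProbabilityMeasure_uniformOn Set.finite_univ Set.univ_nonempty

/-- The total height of a rooted labeled tree on `n` vertices, as a real random variable. -/
def X (n : ℕ) (T : RootedLabeledTree n) : ℝ :=
  T.totalHeight

end RootedLabeledTree

/-- The quantity `W_n = n! / n^(n-1) * ∑_{k=0}^{n-2} n^k / k!`, for `n ≥ 1`. -/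
noncomputable def W (n : ℕ) : ℝ :=
  (n.factorial : ℝ) / (n : ℝ) ^ (n - 1) *
    ∑ k ∈ Finset.range (n - 1), (n : ℝ) ^ k / (k.factorial : ℝ)

/-- The skewness of a real random variable: the third central moment divided by the cube of the
standard deviation. -/
noncomputable def skewness {Ω : Type*} [MeasurableSpace Ω] (Y : Ω → ℝ) (μ : Measure Ω) : ℝ :=
  centralMoment Y 3 μ / √(variance Y μ) ^ 3

/-- The standardization of a real random variable: subtract the mean, then divide by the standard
deviation. -/
noncomputable def standardize {Ω : Type*} [MeasurableSpace Ω] (Y : Ω → ℝ) (μ : Measure Ω) :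
    Ω → ℝ :=
  fun ω => (Y ω - ∫ ω', Y ω' ∂μ) / √(variance Y μ)

/-!
The third moment is found from one recursion. In a rooted tree on `n` vertices mark a vertex other
than the root and cut the edge that joins its branch to the root. This is a bijection onto the pairs
of a tree on a set of `k` vertices with a marked vertex and a tree on the other `n - k` vertices, and
the total height is the sum of the two total heights and `k` (`TreeOn.sum_marked`,
`RootedLabeledTree.sum_totalHeight_rec`).

Let `T, F₁, F₂, F₃` be the exponential generating functions of the sums over all trees of the powers
of orders `0, …, 3` of the total height, and write `θ = x d/dx`. In order `0` the recursion reads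
`θ T - T = T θ T`; so `U = 1 + θ T` is `1 / (1 - T)` and `θ U = U³ - U²`. In the orders `1, 2, 3` it
is a linear differential equation with coefficients polynomial in `T` and `U`, which determines
`F₁, F₂, F₃` as polynomials in `U` (`TreeSeries.egf_one`, `TreeSeries.egf_two`,
`TreeSeries.egf_three`). These polynomials are combinations of the `θ`-iterates of `U` and `U²`. The
coefficients of `U` are `n ^ n / n!` and those of `U²` are `∑_{k ≤ n} n ^ k / k!`, by the relations
`T U = U - 1` and `θ (T ^ j) = j T ^ j U`, which amount to Lagrange inversion
(`TreeSeries.coeff_egf_zero_pow_mul_U`). So `n ^ n` and `W n` are all that enters the moments.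

For the asymptotics, `W n / n + 2` is the sum of the products `∏_{i < j} (1 - i / n)`. These lie
between Gaussian exponentials, so the sum is asymptotic to `√(π n / 2)`
(`TreeSeries.tendsto_sum_birthday`).

That no normal law is a limit point follows from two facts. The total height is nonnegative, and its
mean is of the order of its standard deviation, so every limit point of the standardized variables is
bounded below and cannot be a normal law of positive variance. Moreover, for variables bounded below
the convergent skewness bounds the third absolute moment; the variance `1` therefore cannot escape to
infinity and no limit point is a point mass (`TreeSeries.le_integral_min_sq`).
-/

/-! ### Trees on a finite type -/

/-- A rooted tree with vertex type `α`, encoded like `RootedLabeledTree`: a root and a parent map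
that fixes the root and whose iterates lead from every vertex to the root. -/
@[ext]
structure TreeOn (α : Type*) where
  root : α
  parent : α → α
  parent_root : parent root = root
  reaches_root : ∀ v, ∃ k : ℕ, parent^[k] v = root

namespace TreeOn

variable {α β : Type*}

instance [Finite α] : Finite (TreeOn α) :=
  Finite.of_injective (fun T : TreeOn α => (T.root, T.parent)) fun S T h => by
    simp only [Prod.mk.injEq] at h
    exact TreeOn.ext h.1 h.2

noncomputable instance [Finite α] : Fintype (TreeOn α) := Fintype.ofFinite _

open Classical in
/-- The distance of a vertex to the root. -/
noncomputable def height (T : TreeOn α) (v : α) : ℕ := Nat.find (T.reaches_root v)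

/-- The sum of the heights of all vertices. -/
noncomputable def totalHeight [Fintype α] (T : TreeOn α) : ℕ := ∑ v, T.height v

@[simp]
theorem height_root (T : TreeOn α) : T.height T.root = 0 := by
  classical
  simp [height, Nat.find_eq_zero]

theorem height_eq_succ (T : TreeOn α) {v : α} (hv : v ≠ T.root) :
    T.height v = T.height (T.parent v) + 1 := by
  classical
  exact Nat.find_comp_succ (T.reaches_root v) (T.reaches_root (T.parent v)) (by simpa using hv)

/-- Induction along the edges of a tree, away from the root. -/
theorem induction (T : TreeOn α) {P : α → Prop} (root : P T.root)
    (step : ∀ v, v ≠ T.root → P (T.parent v) → P v) (v : α) : P v := by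
  induction h : T.height v using Nat.strong_induction_on generalizing v with
  | _ m ih =>
    by_cases hv : v = T.root
    · exact hv ▸ root
    · exact step v hv (ih _ (by rw [← h, T.height_eq_succ hv]; omega) _ rfl)

/-- The height is the only function that vanishes at the root and increases by one along every
edge; this is how the heights in relabelled and glued trees are found. -/
theorem height_eq_of_rec (T : TreeOn α) {g : α → ℕ} (h0 : g T.root = 0)
    (hs : ∀ v, v ≠ T.root → g v = g (T.parent v) + 1) (v : α) : T.height v = g v := by
  refine T.induction (P := fun v => T.height v = g v) (by simp [h0]) (fun v hv ih => ?_) v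
  rw [T.height_eq_succ hv, hs v hv, ih]

/-- A parent map along which some natural-valued function decreases, except at the root, leads to
the root. -/
theorem exists_iterate_eq_of_lt {r : α} {p : α → α} (g : α → ℕ)
    (hg : ∀ v, v ≠ r → g (p v) < g v) (v : α) : ∃ k : ℕ, p^[k] v = r := by
  induction h : g v using Nat.strong_induction_on generalizing v with
  | _ m ih =>
    by_cases hv : v = r
    · exact ⟨0, hv⟩
    · obtain ⟨k, hk⟩ := ih _ (h ▸ hg v hv) _ rfl
      exact ⟨k + 1, hk⟩

/-- Relabelling the vertices of a tree. -/
def map (e : α ≃ β) (T : TreeOn α) : TreeOn β where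
  root := e T.root
  parent v := e (T.parent (e.symm v))
  parent_root := by simp [T.parent_root]
  reaches_root v := by
    obtain ⟨k, hk⟩ := T.reaches_root (e.symm v)
    refine ⟨k, ?_⟩
    have h : Function.Semiconj e T.parent (fun v => e (T.parent (e.symm v))) := fun x => by simp
    have := (h.iterate_right k) (e.symm v)
    rw [hk, e.apply_symm_apply] at this
    exact this.symm

/-- Relabelling as an equivalence. -/
def mapEquiv (e : α ≃ β) : TreeOn α ≃ TreeOn β where
  toFun := map e
  invFun := map e.symm
  left_inv T := by ext <;> simp [map]
  right_inv T := by ext <;> simp [map]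

theorem totalHeight_map [Fintype α] [Fintype β] (e : α ≃ β) (T : TreeOn α) :
    (T.map e).totalHeight = T.totalHeight := by
  unfold totalHeight
  rw [← e.sum_comp]
  refine Finset.sum_congr rfl fun v _ => ?_
  rw [(T.map e).height_eq_of_rec (g := fun w => T.height (e.symm w)) (by simp [map])]
  · simp
  · intro w hw
    rw [T.height_eq_succ]
    · simp [map]
    · intro h
      exact hw (by simp [map, ← h])

/-- The vertex below the root on the path from `v` to the root, for `v` other than the root. It
names the branch of the tree that contains `v`. -/
noncomputable def branch (T : TreeOn α) (v : α) : α := T.parent^[T.height v - 1] v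

theorem branch_of_parent_eq (T : TreeOn α) {v : α} (h : T.parent v = T.root) : T.branch v = v := by
  have : T.height v - 1 = 0 := by
    by_cases hv : v = T.root
    · simp [hv]
    · rw [T.height_eq_succ hv, h, height_root]
  rw [branch, this]; rfl

theorem branch_parent (T : TreeOn α) {v : α} (h : T.parent v ≠ T.root) :
    T.branch (T.parent v) = T.branch v := by
  have hv : v ≠ T.root := by
    rintro rfl
    exact h T.parent_root
  rw [branch, branch, T.height_eq_succ hv, T.height_eq_succ h]
  rfl

theorem branch_spec (T : TreeOn α) (v : α) (hv : v ≠ T.root) :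
    T.branch v ≠ T.root ∧ T.parent (T.branch v) = T.root := by
  refine T.induction (P := fun v => v ≠ T.root →
    (T.branch v ≠ T.root ∧ T.parent (T.branch v) = T.root)) (fun h => (h rfl).elim)
    (fun v hv ih _ => ?_) v hv
  by_cases h : T.parent v = T.root
  · rw [T.branch_of_parent_eq h]
    exact ⟨hv, h⟩
  · rw [← T.branch_parent h]
    exact ih h

/-! ### Gluing a branch to the root -/

section Glue

variable [DecidableEq α]

/-- The parent map of the tree obtained by hanging a tree on `S` from the root of a tree on the
complement of `S`. -/
def glueParent (S : Finset α) (A : TreeOn {x // x ∈ S}) (B : TreeOn {x // x ∉ S}) (w : α) : α :=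
  if h : w ∈ S then
    if w = A.root then B.root else A.parent ⟨w, h⟩
  else B.parent ⟨w, h⟩

/-- The heights in the tree with parent map `glueParent`. -/
noncomputable def glueHeight (S : Finset α) (A : TreeOn {x // x ∈ S}) (B : TreeOn {x // x ∉ S})
    (w : α) : ℕ :=
  if h : w ∈ S then A.height ⟨w, h⟩ + 1 else B.height ⟨w, h⟩

theorem glueHeight_eq_succ (S : Finset α) (A : TreeOn {x // x ∈ S}) (B : TreeOn {x // x ∉ S})
    {w : α} (hw : w ≠ B.root) :
    glueHeight S A B w = glueHeight S A B (glueParent S A B w) + 1 := by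
  by_cases h : w ∈ S
  · by_cases h' : w = A.root
    · have e : (⟨w, h⟩ : {x // x ∈ S}) = A.root := Subtype.ext h'
      have hB := B.root.2
      simp [glueHeight, glueParent, h', hB]
    · have e : (⟨w, h⟩ : {x // x ∈ S}) ≠ A.root := fun h => h' (congrArg Subtype.val h)
      simp [glueHeight, glueParent, h, h', A.height_eq_succ e]
  · have e : (⟨w, h⟩ : {x // x ∉ S}) ≠ B.root := fun h => hw (congrArg Subtype.val h)
    have := (B.parent ⟨w, h⟩).2
    simp [glueHeight, glueParent, h, B.height_eq_succ e, this]

/-- The tree obtained by hanging a tree on `S` from the root of a tree on the complement of `S`. -/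
def glue (S : Finset α) (A : TreeOn {x // x ∈ S}) (B : TreeOn {x // x ∉ S}) : TreeOn α where
  root := B.root
  parent := glueParent S A B
  parent_root := by
    have := B.root.2
    simp [glueParent, this, B.parent_root]
  reaches_root := exists_iterate_eq_of_lt (glueHeight S A B) fun v hv => by
    rw [glueHeight_eq_succ S A B hv]; omega

/-- Every vertex of `S` moves down by one when the tree on `S` is hung from the new root, whence the
summand `S.card`. -/
theorem totalHeight_glue [Fintype α] (S : Finset α) (A : TreeOn {x // x ∈ S})
    (B : TreeOn {x // x ∉ S}) :
    (glue S A B).totalHeight = A.totalHeight + B.totalHeight + S.card := by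
  have h : ∀ v, (glue S A B).height v = glueHeight S A B v := by
    refine height_eq_of_rec _ ?_ fun v hv => glueHeight_eq_succ S A B hv
    have := B.root.2
    simp [glue, glueHeight, this]
  simp only [totalHeight, h]
  rw [← Fintype.sum_subtype_add_sum_subtype (fun x => x ∈ S)]
  have h1 : ∀ x : {x // x ∈ S}, glueHeight S A B x = A.height x + 1 := fun x => by
    simp [glueHeight]
  have h2 : ∀ x : {x // x ∉ S}, glueHeight S A B x = B.height x := fun x => by
    simp [glueHeight, x.2]
  simp only [h1, h2, Finset.sum_add_distrib, Finset.sum_const, Finset.card_univ,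
    Fintype.card_coe, smul_eq_mul, mul_one]
  rw [add_right_comm]
  congr!

/-- In a glued tree, `S` is exactly one branch, so `S` can be recovered from the tree and any one of
the vertices of `S`. -/
theorem mem_iff_branch_glue (S : Finset α) (A : TreeOn {x // x ∈ S}) (B : TreeOn {x // x ∉ S})
    (w : α) (hw : w ≠ (glue S A B).root) : w ∈ S ↔ (glue S A B).branch w = A.root := by
  refine (glue S A B).induction (P := fun w => w ≠ (glue S A B).root →
    (w ∈ S ↔ (glue S A B).branch w = A.root)) (fun h => (h rfl).elim) (fun v hv ih _ => ?_) w hw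
  by_cases hp : (glue S A B).parent v = (glue S A B).root
  · rw [branch_of_parent_eq _ hp]
    refine ⟨fun h => ?_, fun h => h ▸ A.root.2⟩
    by_contra h'
    have hp' : ((A.parent ⟨v, h⟩ : {x // x ∈ S}) : α) = B.root := by
      simpa [glue, glueParent, h, h'] using hp
    exact B.root.2 (hp' ▸ (A.parent ⟨v, h⟩).2)
  · rw [← branch_parent _ hp, ← ih hp]
    by_cases h : v ∈ S
    · have h' : v ≠ A.root := by
        intro h'
        apply hp
        have := A.root.2
        simp [glue, glueParent, h']
      simp [glue, glueParent, h, h']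
    · have := (B.parent ⟨v, h⟩).2
      simp [glue, glueParent, h, this]

/-- Hanging a tree on `S` from a tree on the complement of `S`, with a marked vertex in `S`. -/
def glueMarked (x : Σ S : Finset α, {v // v ∈ S} × TreeOn {x // x ∈ S} × TreeOn {x // x ∉ S}) :
    Σ T : TreeOn α, {v // v ≠ T.root} :=
  ⟨glue x.1 x.2.2.1 x.2.2.2, x.2.1, fun h => x.2.2.2.root.2 (by
    have := x.2.1.2
    rw [h] at this
    exact this)⟩

theorem glueMarked_injective : Function.Injective (glueMarked (α := α)) := by
  rintro ⟨S, v, A, B⟩ ⟨S', v', A', B'⟩ h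
  have hT : glue S A B = glue S' A' B' := congrArg Sigma.fst h
  have hv : (v : α) = v' :=
    congrArg (fun y : Σ T : TreeOn α, {v // v ≠ T.root} => (y.2 : α)) h
  have hr : (B.root : α) = B'.root := congrArg TreeOn.root hT
  have hne : (v : α) ≠ (glue S A B).root := (glueMarked ⟨S, v, A, B⟩).2.2
  have hb := (mem_iff_branch_glue S A B v hne).1 v.2
  have hb' := (mem_iff_branch_glue S' A' B' v (hT ▸ hne)).1 (hv ▸ v'.2)
  have hAr : (A.root : α) = A'.root := by rw [← hb, ← hb', hT]
  have hS : S = S' := by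
    ext w
    by_cases hw : w = (glue S A B).root
    · have h1 : w ∉ S := hw ▸ B.root.2
      have h2 : w ∉ S' := (hw.trans hr) ▸ B'.root.2
      simp [h1, h2]
    · rw [mem_iff_branch_glue S A B w hw, mem_iff_branch_glue S' A' B' w (hT ▸ hw), hT, hAr]
  subst hS
  obtain rfl : v = v' := Subtype.ext hv
  have hp : ∀ w, glueParent S A B w = glueParent S A' B' w := fun w =>
    congrFun (congrArg TreeOn.parent hT) w
  obtain rfl : A = A' := by
    refine TreeOn.ext (Subtype.ext hAr) (funext fun w => ?_)
    by_cases hw : w = A.root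
    · rw [hw, A.parent_root, show A.root = A'.root from Subtype.ext hAr, A'.parent_root]
    · have h1 : (w : α) ≠ A.root := fun h => hw (Subtype.ext h)
      have h2 : (w : α) ≠ A'.root := hAr ▸ h1
      have := hp w
      simp only [glueParent, w.2, h1, h2, dite_true, if_false] at this
      exact Subtype.ext this
  obtain rfl : B = B' := by
    refine TreeOn.ext (Subtype.ext hr) (funext fun w => ?_)
    have := hp w
    simp only [glueParent, w.2, dite_false] at this
    exact Subtype.ext this
  rfl

/-- A tree with a marked vertex other than the root is obtained by gluing: cut the edge that joins
the branch of the marked vertex to the root. -/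
theorem glueMarked_surjective [Fintype α] : Function.Surjective (glueMarked (α := α)) := by
  rintro ⟨T, v, hv⟩
  obtain ⟨hc, hpc⟩ := T.branch_spec v hv
  set c := T.branch v with hcdef
  have hbc : T.branch c = c := T.branch_of_parent_eq hpc
  let S : Finset α := Finset.univ.filter fun w => w ≠ T.root ∧ T.branch w = c
  have hS : ∀ w, w ∈ S ↔ w ≠ T.root ∧ T.branch w = c := by simp [S]
  have hup : ∀ w ∈ S, w ≠ c → T.parent w ∈ S := fun w hw hwc => by
    obtain ⟨h1, h2⟩ := (hS w).1 hw
    have : T.parent w ≠ T.root := fun h => hwc (by rw [← h2, T.branch_of_parent_eq h])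
    exact (hS _).2 ⟨this, by rw [T.branch_parent this, h2]⟩
  have hout : ∀ w, w ∉ S → T.parent w ∉ S := fun w hw hp => by
    obtain ⟨h1, h2⟩ := (hS _).1 hp
    refine hw ((hS w).2 ⟨?_, by rw [← T.branch_parent h1, h2]⟩)
    rintro rfl
    exact h1 T.parent_root
  let A : TreeOn {x // x ∈ S} :=
    { root := ⟨c, (hS c).2 ⟨hc, hbc⟩⟩
      parent := fun w => if h : (w : α) = c then w else ⟨T.parent w, hup w w.2 h⟩
      parent_root := by simp
      reaches_root := exists_iterate_eq_of_lt (fun w => T.height w) fun w hw => by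
        have h : (w : α) ≠ c := fun h => hw (Subtype.ext h)
        simp only [h, dite_false]
        rw [T.height_eq_succ ((hS w).1 w.2).1]
        omega }
  let B : TreeOn {x // x ∉ S} :=
    { root := ⟨T.root, by simp [hS]⟩
      parent := fun w => ⟨T.parent w, hout w w.2⟩
      parent_root := Subtype.ext T.parent_root
      reaches_root := exists_iterate_eq_of_lt (fun w => T.height w) fun w hw => by
        have h : (w : α) ≠ T.root := fun h => hw (Subtype.ext h)
        rw [T.height_eq_succ h]
        exact Nat.lt_succ_self _ }
  have hglue : glue S A B = T := by
    refine TreeOn.ext rfl (funext fun w => ?_)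
    change glueParent S A B w = T.parent w
    by_cases h : w ∈ S
    · by_cases h' : w = c
      · simp [glueParent, A, B, h', hpc]
      · simp [glueParent, A, h, h']
    · simp [glueParent, B, h]
  refine ⟨⟨S, ⟨v, (hS v).2 ⟨hv, rfl⟩⟩, A, B⟩, ?_⟩
  refine Sigma.ext hglue ?_
  refine (Subtype.heq_iff_coe_eq fun x => ?_).2 rfl
  change x ≠ (glue S A B).root ↔ _
  rw [hglue]

end Glue

/-- Cutting off the branch of a marked vertex: the basic recursion for the total height. On the
left, `card α - 1` counts the vertices that may be marked; on the right, the factor `S.card` does. -/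
theorem sum_marked [Fintype α] [DecidableEq α] {M : Type*} [AddCommMonoid M] (f : ℕ → M) :
    ∑ T : TreeOn α, (Fintype.card α - 1) • f T.totalHeight =
      ∑ S : Finset α, S.card • ∑ A : TreeOn {x // x ∈ S}, ∑ B : TreeOn {x // x ∉ S},
        f (A.totalHeight + B.totalHeight + S.card) := by
  have h := Function.Bijective.sum_comp
    (⟨glueMarked_injective, glueMarked_surjective⟩ : Function.Bijective (glueMarked (α := α)))
    (fun y => f y.1.totalHeight)
  rw [Fintype.sum_sigma, Fintype.sum_sigma] at h
  refine Eq.trans ?_ (h.symm.trans ?_)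
  · refine Finset.sum_congr rfl fun T _ => ?_
    simp [Fintype.card_subtype_compl]
  · refine Finset.sum_congr rfl fun S _ => ?_
    simp only [glueMarked, totalHeight_glue]
    rw [Fintype.sum_prod_type]
    simp [Fintype.sum_prod_type]

end TreeOn

/-! ### The recursion for rooted labeled trees -/

namespace RootedLabeledTree

/-- Rooted labeled trees are the trees on `Fin n`. -/
def equivTreeOn (n : ℕ) : RootedLabeledTree n ≃ TreeOn (Fin n) where
  toFun T := ⟨T.root, T.parent, T.parent_root, T.reaches_root⟩
  invFun T := ⟨T.root, T.parent, T.parent_root, T.reaches_root⟩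
  left_inv _ := rfl
  right_inv _ := rfl

theorem totalHeight_equivTreeOn {n : ℕ} (T : RootedLabeledTree n) :
    (equivTreeOn n T).totalHeight = T.totalHeight := by
  unfold totalHeight TreeOn.totalHeight
  refine Finset.sum_congr rfl fun v _ => ?_
  refine (equivTreeOn n T).height_eq_of_rec (g := T.height) ?_ (fun w hw => ?_) v
  · simp [height, equivTreeOn, Nat.find_eq_zero]
  · exact Nat.find_comp_succ (T.reaches_root w) (T.reaches_root (T.parent w))
      (by simpa [equivTreeOn] using hw)

noncomputable instance (n : ℕ) : Fintype (RootedLabeledTree n) := Fintype.ofFinite _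

/-- Sums over the trees on a finite type depend only on its cardinality. -/
theorem sum_treeOn {α : Type*} [Fintype α] {M : Type*} [AddCommMonoid M] (f : ℕ → M) {n : ℕ}
    (hn : Fintype.card α = n) :
    ∑ T : TreeOn α, f T.totalHeight = ∑ T : RootedLabeledTree n, f T.totalHeight := by
  rw [← (equivTreeOn n).symm.sum_comp, ← (TreeOn.mapEquiv (Fintype.equivFinOfCardEq hn)).sum_comp]
  refine Finset.sum_congr rfl fun T _ => congrArg f ?_
  rw [← totalHeight_equivTreeOn, Equiv.apply_symm_apply]
  exact (TreeOn.totalHeight_map _ T).symm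

/-- The recursion on which everything rests: a tree on `n` vertices with a marked vertex other than
the root is a branch of some size `k` with a marked vertex, together with a tree on the remaining
`n - k` vertices. -/
theorem sum_totalHeight_rec {M : Type*} [AddCommMonoid M] (f : ℕ → M) (n : ℕ) :
    (n - 1) • ∑ T : RootedLabeledTree n, f T.totalHeight =
      ∑ k ∈ Finset.range (n + 1), n.choose k • k • ∑ A : RootedLabeledTree k,
        ∑ B : RootedLabeledTree (n - k), f (A.totalHeight + B.totalHeight + k) := by
  have h := TreeOn.sum_marked (α := Fin n) f
  rw [← Finset.smul_sum, Fintype.card_fin, sum_treeOn f (Fintype.card_fin n)] at h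
  rw [h]
  have h2 := Finset.sum_powerset_apply_card (fun k => k • ∑ A : RootedLabeledTree k,
        ∑ B : RootedLabeledTree (n - k), f (A.totalHeight + B.totalHeight + k))
        (x := (Finset.univ : Finset (Fin n)))
  rw [Finset.card_fin, Finset.powerset_univ] at h2
  rw [← h2]
  refine Finset.sum_congr rfl fun S _ => ?_
  congr 1
  rw [← sum_treeOn (α := {x // x ∈ S}) (fun a => ∑ B : RootedLabeledTree (n - S.card),
    f (a + B.totalHeight + S.card)) (by simp)]
  refine Finset.sum_congr rfl fun A _ => ?_
  rw [← sum_treeOn (α := {x // x ∉ S}) (fun b => f (A.totalHeight + b + S.card))]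
  rw [Fintype.card_subtype_compl]
  simp

end RootedLabeledTree

namespace TreeSeries

open PowerSeries hiding mk
open RootedLabeledTree hiding X

/-! ### Generating functions of the moments -/

/-- The sum of the `j`-th powers of the total heights of all rooted labeled trees on `n`
vertices. -/
noncomputable def powerSum (j n : ℕ) : ℝ := ∑ T : RootedLabeledTree n, (T.totalHeight : ℝ) ^ j

theorem sum_sum_pow_mul_pow (i j k l : ℕ) :
    ∑ A : RootedLabeledTree k, ∑ B : RootedLabeledTree l,
      (A.totalHeight : ℝ) ^ i * (B.totalHeight : ℝ) ^ j = powerSum i k * powerSum j l :=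
  (Finset.sum_mul_sum _ _ _ _).symm

instance : IsEmpty (RootedLabeledTree 0) := ⟨fun A => A.root.elim0⟩

instance : Unique (RootedLabeledTree 1) where
  default := ⟨0, fun _ => 0, rfl, fun _ => ⟨1, rfl⟩⟩
  uniq _ := RootedLabeledTree.ext (Subsingleton.elim _ _) (Subsingleton.elim _ _)

theorem powerSum_zero_right (j : ℕ) : powerSum j 0 = 0 := by simp [powerSum]

theorem powerSum_one_right (j : ℕ) : powerSum j 1 = 0 ^ j := by
  have h : ∀ T : RootedLabeledTree 1, T.totalHeight = 0 := fun T => by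
    simp [totalHeight, height, Nat.find_eq_zero, Subsingleton.elim _ T.root]
  simp [powerSum, h]

/-- The Euler operator `x d/dx` on power series. -/
noncomputable def euler : Derivation ℝ ℝ⟦X⟧ ℝ⟦X⟧ := (X : ℝ⟦X⟧) • derivative ℝ

theorem coeff_euler (f : ℝ⟦X⟧) (n : ℕ) : coeff n (euler f) = n * coeff n f := by
  rw [euler, Derivation.smul_apply, smul_eq_mul]
  cases n with
  | zero => simp
  | succ n => rw [coeff_succ_X_mul, coeff_derivative]; push_cast; ring

/-- The exponential generating function of the power sums of order `j`. -/
noncomputable def egf (j : ℕ) : ℝ⟦X⟧ := PowerSeries.mk fun n => powerSum j n / n.factorial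

theorem coeff_egf (j n : ℕ) : coeff n (egf j) = powerSum j n / n.factorial := coeff_mk _ _

/-- The recursion `sum_totalHeight_rec`, read as a statement about generating functions: marking a
vertex other than the root acts as `x d/dx - 1`. -/
theorem coeff_euler_sub_egf (j n : ℕ) :
    coeff n (euler (egf j) - egf j) =
      ∑ p ∈ Finset.HasAntidiagonal.antidiagonal n, (∑ A : RootedLabeledTree p.1, ∑ B : RootedLabeledTree p.2,
        ((A.totalHeight : ℝ) + B.totalHeight + p.1) ^ j) *
          (p.1 / (p.1.factorial * p.2.factorial)) := by
  have h := sum_totalHeight_rec (fun m => (m : ℝ) ^ j) n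
  have h1 : ((n - 1 : ℕ) • powerSum j n : ℝ) = ((n : ℝ) - 1) * powerSum j n := by
    cases n with
    | zero => simp [powerSum_zero_right]
    | succ n => simp
  change (n - 1) • powerSum j n = _ at h
  rw [h1] at h
  have hn : (n.factorial : ℝ) ≠ 0 := by positivity
  rw [map_sub, coeff_euler, coeff_egf]
  rw [show (n : ℝ) * (powerSum j n / n.factorial) - powerSum j n / n.factorial =
    ((n : ℝ) - 1) * powerSum j n / n.factorial by ring, h, Finset.sum_div,
    Finset.Nat.sum_antidiagonal_eq_sum_range_succ_mk]
  refine Finset.sum_congr rfl fun k hk => ?_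
  have hk : k ≤ n := by simpa [Nat.lt_succ_iff] using hk
  have hc : (n.choose k : ℝ) * (k.factorial * (n - k).factorial) = n.factorial := by
    rw [← mul_assoc]; exact_mod_cast Nat.choose_mul_factorial_mul_factorial hk
  simp only [nsmul_eq_mul, Nat.cast_add]
  have h2 : (k.factorial : ℝ) ≠ 0 := by positivity
  have h3 : ((n - k).factorial : ℝ) ≠ 0 := by positivity
  rw [← hc]
  have h4 : (n.choose k : ℝ) ≠ 0 := by exact_mod_cast (Nat.choose_pos hk).ne'
  field_simp

theorem coeff_mul_egf (m i j n : ℕ) :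
    coeff n (euler^[m] (egf i) * egf j) = ∑ p ∈ Finset.HasAntidiagonal.antidiagonal n,
      (p.1 ^ m * powerSum i p.1 * powerSum j p.2) / (p.1.factorial * p.2.factorial) := by
  have h : ∀ k, coeff k (euler^[m] (egf i)) = k ^ m * coeff k (egf i) := by
    intro k
    induction m with
    | zero => simp
    | succ m ih => rw [Function.iterate_succ_apply', coeff_euler, ih]; ring
  rw [coeff_mul]
  refine Finset.sum_congr rfl fun p _ => ?_
  rw [h, coeff_egf, coeff_egf]
  ring

/-- This equation and the following three collect, by the multinomial theorem, the terms of
`(A + B + k) ^ j` in `coeff_euler_sub_egf`; each factor `k` is one more application of `euler`. -/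
theorem euler_egf_zero : euler (egf 0) - egf 0 = euler (egf 0) * egf 0 := by
  ext n
  rw [coeff_euler_sub_egf, show euler (egf 0) * egf 0 = euler^[1] (egf 0) * egf 0 from rfl,
    coeff_mul_egf]
  refine Finset.sum_congr rfl fun p _ => ?_
  have h := sum_sum_pow_mul_pow 0 0 p.1 p.2
  simp only [pow_zero, mul_one] at h
  simp only [pow_zero, h]
  ring

theorem euler_egf_one : euler (egf 1) - egf 1 =
    euler (egf 1) * egf 0 + euler (egf 0) * egf 1 + euler^[2] (egf 0) * egf 0 := by
  ext n
  rw [coeff_euler_sub_egf, show euler (egf 1) * egf 0 = euler^[1] (egf 1) * egf 0 from rfl,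
    show euler (egf 0) * egf 1 = euler^[1] (egf 0) * egf 1 from rfl]
  simp only [map_add, coeff_mul_egf, ← Finset.sum_add_distrib]
  refine Finset.sum_congr rfl fun p _ => ?_
  simp only [← sum_sum_pow_mul_pow, mul_assoc, Finset.mul_sum, Finset.sum_div, Finset.sum_mul,
    ← Finset.sum_add_distrib]
  refine Finset.sum_congr rfl fun A _ => Finset.sum_congr rfl fun B _ => ?_
  ring

theorem euler_egf_two : euler (egf 2) - egf 2 =
    euler (egf 2) * egf 0 + euler (egf 0) * egf 2 + 2 * (euler (egf 1) * egf 1)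
      + 2 * (euler^[2] (egf 1) * egf 0) + 2 * (euler^[2] (egf 0) * egf 1)
      + euler^[3] (egf 0) * egf 0 := by
  ext n
  rw [coeff_euler_sub_egf, show euler (egf 2) * egf 0 = euler^[1] (egf 2) * egf 0 from rfl,
    show euler (egf 0) * egf 2 = euler^[1] (egf 0) * egf 2 from rfl,
    show euler (egf 1) * egf 1 = euler^[1] (egf 1) * egf 1 from rfl]
  simp only [two_mul, map_add, coeff_mul_egf, ← Finset.sum_add_distrib]
  refine Finset.sum_congr rfl fun p _ => ?_
  simp only [← sum_sum_pow_mul_pow, mul_assoc, Finset.mul_sum, Finset.sum_div, Finset.sum_mul,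
    ← Finset.sum_add_distrib]
  refine Finset.sum_congr rfl fun A _ => Finset.sum_congr rfl fun B _ => ?_
  ring

theorem euler_egf_three : euler (egf 3) - egf 3 =
    euler (egf 3) * egf 0 + euler (egf 0) * egf 3 + 3 • (euler (egf 2) * egf 1)
      + 3 • (euler (egf 1) * egf 2) + 3 • (euler^[2] (egf 2) * egf 0)
      + 6 • (euler^[2] (egf 1) * egf 1) + 3 • (euler^[2] (egf 0) * egf 2)
      + 3 • (euler^[3] (egf 1) * egf 0) + 3 • (euler^[3] (egf 0) * egf 1)
      + euler^[4] (egf 0) * egf 0 := by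
  ext n
  rw [coeff_euler_sub_egf, show euler (egf 3) * egf 0 = euler^[1] (egf 3) * egf 0 from rfl,
    show euler (egf 0) * egf 3 = euler^[1] (egf 0) * egf 3 from rfl,
    show euler (egf 2) * egf 1 = euler^[1] (egf 2) * egf 1 from rfl,
    show euler (egf 1) * egf 2 = euler^[1] (egf 1) * egf 2 from rfl]
  simp only [map_add, map_nsmul, coeff_mul_egf]
  simp only [nsmul_eq_mul, Finset.mul_sum, ← Finset.sum_add_distrib]
  refine Finset.sum_congr rfl fun p _ => ?_
  simp only [← sum_sum_pow_mul_pow, mul_assoc, Finset.mul_sum, Finset.sum_div, Finset.sum_mul,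
    ← Finset.sum_add_distrib]
  refine Finset.sum_congr rfl fun A _ => Finset.sum_congr rfl fun B _ => ?_
  push_cast
  ring

/-! ### Solution of the differential equations -/

/-- The exponential generating function `U = 1 / (1 - T)` of the trees with a further marked
vertex (and `1` for the empty structure), where `T` is that of the rooted trees. -/
noncomputable def U : ℝ⟦X⟧ := 1 + euler (egf 0)

theorem egf_zero_mul_U : egf 0 * U = U - 1 := by
  unfold U
  linear_combination -euler_egf_zero

theorem coeff_zero_U : coeff 0 U = 1 := by
  simp only [U, map_add, coeff_euler]
  simp

theorem coeff_zero_U_pow (k : ℕ) : coeff 0 (U ^ k) = 1 := by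
  have := coeff_zero_U
  rw [coeff_zero_eq_constantCoeff] at this ⊢
  simp [this]

theorem coeff_one_U : coeff 1 U = 1 := by
  simp only [U, map_add, coeff_euler, coeff_egf, powerSum_one_right]
  simp [coeff_one]

theorem euler_egf_zero_eq : euler (egf 0) = U - 1 := by
  unfold U; ring

theorem euler_U : euler U = U ^ 3 - U ^ 2 := by
  have h := congrArg euler egf_zero_mul_U
  simp only [Derivation.leibniz, map_sub, Derivation.map_one_eq_zero, smul_eq_mul] at h
  rw [euler_egf_zero_eq] at h
  linear_combination (-U) * h + (euler U) * egf_zero_mul_U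

theorem euler_U_pow (k : ℕ) : euler (U ^ (k + 1)) = (k + 1 : ℕ) • (U ^ (k + 3) - U ^ (k + 2)) := by
  rw [Derivation.leibniz_pow, euler_U]
  simp only [smul_eq_mul, nsmul_eq_mul, Nat.add_sub_cancel]
  ring

/-- The equation for the generating function `f` of the moments of order `j` is linear in `f`, the
lower orders entering through `r` only. Multiplied by `U` it becomes `x f' - U ^ 2 f = U r`, whose
solution is determined by the coefficients of orders `0` and `1`. -/
theorem eq_of_euler_eq {f g r : ℝ⟦X⟧} (hf : euler f - f = euler f * egf 0 + euler (egf 0) * f + r)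
    (hg : euler g - U ^ 2 * g = U * r) (h0 : coeff 0 f = coeff 0 g) (h1 : coeff 1 f = coeff 1 g) :
    f = g := by
  have hd : euler (f - g) = U ^ 2 * (f - g) := by
    rw [euler_egf_zero_eq] at hf
    rw [map_sub]
    linear_combination U * hf - hg + euler f * egf_zero_mul_U
  rw [← sub_eq_zero]
  ext n
  rw [map_zero]
  induction n using Nat.strong_induction_on with
  | _ n ih =>
    match n, ih with
    | 0, _ => rw [map_sub, h0, sub_self]
    | 1, _ => rw [map_sub, h1, sub_self]
    | n + 2, ih =>
      have h := congrArg (coeff (n + 2)) hd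
      rw [coeff_euler, coeff_mul, Finset.Nat.sum_antidiagonal_succ, Finset.sum_eq_zero] at h
      · rw [coeff_zero_U_pow] at h
        push_cast at h
        have h3 : ((n : ℝ) + 1) * coeff (n + 2) (f - g) = 0 := by linear_combination h
        exact (mul_eq_zero.1 h3).resolve_left (by positivity)
      · intro p hp
        rw [ih p.2, mul_zero]
        have := Finset.HasAntidiagonal.mem_antidiagonal.1 hp
        omega

theorem coeff_zero_egf (j : ℕ) : coeff 0 (egf j) = 0 := by simp [coeff_egf, powerSum_zero_right]

theorem coeff_one_egf (j : ℕ) : coeff 1 (egf j) = 0 ^ j := by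
  simp [coeff_egf, powerSum_one_right]

theorem coeff_one_U_pow (k : ℕ) : coeff 1 (U ^ k) = k := by
  cases k with
  | zero => simp [coeff_one]
  | succ k =>
    rw [coeff_one_pow, ← coeff_zero_eq_constantCoeff, coeff_zero_U, coeff_one_U]
    simp

/-- The generating functions of the moments are polynomials in `U`. The coefficients here and below
result from solving the second equation of `eq_of_euler_eq` for a polynomial in `U`, from its top
coefficient down. -/
theorem egf_one : egf 1 = U ^ 2 - 2 • U ^ 1 + 1 := by
  refine eq_of_euler_eq (r := euler^[2] (egf 0) * egf 0) euler_egf_one ?_ ?_ ?_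
  · simp only [Function.iterate_succ_apply, Function.iterate_zero_apply, map_add, map_sub,
      map_nsmul, euler_egf_zero_eq, euler_U, euler_U_pow, Derivation.map_one_eq_zero]
    simp only [nsmul_eq_mul]
    push_cast
    linear_combination (-U ^ 3 + U ^ 2) * egf_zero_mul_U
  · simp only [map_add, map_sub, map_nsmul, coeff_zero_egf, coeff_zero_U_pow]
    norm_num
  · simp only [map_add, map_sub, map_nsmul, coeff_one_egf, coeff_one_U_pow]
    norm_num [coeff_one]

theorem egf_two : egf 2 = 5 • U ^ 5 - 14 • U ^ 4 + 13 • U ^ 3 - 4 • U ^ 2 := by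
  refine eq_of_euler_eq (r := 2 * (euler (egf 1) * egf 1)
      + 2 * (euler^[2] (egf 1) * egf 0) + 2 * (euler^[2] (egf 0) * egf 1)
      + euler^[3] (egf 0) * egf 0) (by rw [euler_egf_two]; ring) ?_ ?_ ?_
  · simp only [Function.iterate_succ_apply, Function.iterate_zero_apply, map_add, map_sub,
      map_nsmul, euler_egf_zero_eq, euler_U, euler_U_pow, Derivation.map_one_eq_zero, egf_one, map_zero]
    -- eliminates `egf 0`, leaving a polynomial identity in `U`
    have hp : ∀ p : ℝ⟦X⟧, U * (p * egf 0) = p * (U - 1) := fun p => by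
      rw [← egf_zero_mul_U]; ring
    simp only [mul_add, mul_left_comm U 2, hp]
    simp only [nsmul_eq_mul]
    push_cast
    ring
  · simp only [map_add, map_sub, map_nsmul, coeff_zero_egf, coeff_zero_U_pow]
    norm_num
  · simp only [map_add, map_sub, map_nsmul, coeff_one_egf, coeff_one_U_pow]
    norm_num [coeff_one]

theorem egf_three : egf 3 = 90 • U ^ 8 - 353 • U ^ 7 + 536 • U ^ 6 - 389 • U ^ 5 + 132 • U ^ 4
    - 16 • U ^ 3 := by
  refine eq_of_euler_eq (r := 3 • (euler (egf 2) * egf 1)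
      + 3 • (euler (egf 1) * egf 2) + 3 • (euler^[2] (egf 2) * egf 0)
      + 6 • (euler^[2] (egf 1) * egf 1) + 3 • (euler^[2] (egf 0) * egf 2)
      + 3 • (euler^[3] (egf 1) * egf 0) + 3 • (euler^[3] (egf 0) * egf 1)
      + euler^[4] (egf 0) * egf 0) (by rw [euler_egf_three]; ring) ?_ ?_ ?_
  · simp only [Function.iterate_succ_apply, Function.iterate_zero_apply, map_add, map_sub,
      map_nsmul, euler_egf_zero_eq, euler_U, euler_U_pow, Derivation.map_one_eq_zero, map_zero,
      egf_one, egf_two]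
    -- eliminates `egf 0`, leaving a polynomial identity in `U`
    have hp : ∀ p : ℝ⟦X⟧, U * (p * egf 0) = p * (U - 1) := fun p => by
      rw [← egf_zero_mul_U]; ring
    simp only [mul_add, mul_smul_comm, hp]
    simp only [nsmul_eq_mul]
    push_cast
    ring
  · simp only [map_add, map_sub, map_nsmul, coeff_zero_egf, coeff_zero_U_pow]
    norm_num
  · simp only [map_add, map_sub, map_nsmul, coeff_one_egf, coeff_one_U_pow]
    norm_num [coeff_one]

/-! ### Coefficients -/

/-- A case of Lagrange inversion. It follows from the two relations `T U = U - 1` and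
`x d/dx T ^ j = j T ^ j U` by descending induction on the exponent `n - m`. -/
theorem coeff_egf_zero_pow_mul_U {n m : ℕ} (hm : m ≤ n) :
    coeff n (egf 0 ^ (n - m) * U) = (n : ℝ) ^ m / m.factorial := by
  induction m with
  | zero =>
    obtain ⟨S, hS⟩ : (X : ℝ⟦X⟧) ∣ egf 0 := by
      rw [X_dvd_iff, ← coeff_zero_eq_constantCoeff, coeff_zero_egf]
    have hS0 : constantCoeff S = 1 := by
      have := coeff_one_egf 0
      rw [hS, show (1 : ℕ) = 0 + 1 from rfl, coeff_succ_X_mul] at this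
      simpa using this
    have hU : constantCoeff U = 1 := by rw [← coeff_zero_eq_constantCoeff, coeff_zero_U]
    rw [hS, Nat.sub_zero, mul_pow, mul_assoc, show coeff n (X ^ n * (S ^ n * U)) =
      coeff (0 + n) (X ^ n * (S ^ n * U)) by rw [zero_add], coeff_X_pow_mul]
    simp [hS0, hU]
  | succ m ih =>
    obtain ⟨j, rfl⟩ : ∃ j, n = j + (m + 1) := ⟨n - (m + 1), by omega⟩
    have h := ih (by omega)
    rw [show j + (m + 1) - m = j + 1 by omega] at h
    rw [show j + (m + 1) - (m + 1) = j by omega]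
    set n := j + (m + 1) with hn
    have e1 : egf 0 ^ (j + 1) * U = egf 0 ^ j * U - egf 0 ^ j := by
      rw [pow_succ, mul_assoc, egf_zero_mul_U]; ring
    have e2 : euler (egf 0 ^ j) = (j : ℕ) • (egf 0 ^ j * U) := by
      rw [Derivation.leibniz_pow, euler_egf_zero_eq, ← egf_zero_mul_U]
      cases j with
      | zero => simp
      | succ j => simp only [smul_eq_mul, nsmul_eq_mul, Nat.add_sub_cancel]; ring
    have e3 := congrArg (coeff n) e2
    rw [coeff_euler, map_nsmul, nsmul_eq_mul] at e3
    have e4 := congrArg (coeff n) e1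
    rw [h, map_sub] at e4
    have hn0 : (n : ℝ) = j + (m + 1) := by rw [hn]; push_cast; ring
    have hm0 : (m.factorial : ℝ) ≠ 0 := by positivity
    have hm1 : (m : ℝ) + 1 ≠ 0 := by positivity
    rw [Nat.factorial_succ]
    push_cast
    rw [eq_div_iff (by positivity)]
    have e5 : ((m : ℝ) + 1) * coeff n (egf 0 ^ j * U) = n * ((n : ℝ) ^ m / m.factorial) := by
      linear_combination (coeff n (egf 0 ^ j * U)) * (-hn0) + e3 - n * e4
    rw [mul_comm ((m : ℝ) + 1), mul_comm, mul_assoc, e5]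
    field_simp
    ring

theorem coeff_U (n : ℕ) : coeff n U = (n : ℝ) ^ n / n.factorial := by
  simpa using coeff_egf_zero_pow_mul_U (le_refl n)

/-- This is where the partial sums of the exponential series come from: `U ^ 2 = ∑ j, T ^ j * U`. -/
theorem coeff_U_sq (n : ℕ) :
    coeff n (U ^ 2) = ∑ m ∈ Finset.range (n + 1), (n : ℝ) ^ m / m.factorial := by
  have h := geom_sum_mul_neg (egf 0) (n + 1)
  have h2 : U ^ 2 = ∑ i ∈ Finset.range (n + 1), egf 0 ^ i * U + egf 0 ^ (n + 1) * U ^ 2 := by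
    rw [← Finset.sum_mul]
    linear_combination (-U ^ 2) * h -
      U * (∑ i ∈ Finset.range (n + 1), egf 0 ^ i) * egf_zero_mul_U
  have h3 : coeff n (egf 0 ^ (n + 1) * U ^ 2) = 0 := by
    obtain ⟨S, hS⟩ : (X : ℝ⟦X⟧) ∣ egf 0 := by
      rw [X_dvd_iff, ← coeff_zero_eq_constantCoeff, coeff_zero_egf]
    rw [hS, mul_pow, mul_assoc, coeff_X_pow_mul']
    simp
  rw [h2, map_add, h3, add_zero, map_sum, ← Finset.sum_range_reflect]
  refine Finset.sum_congr rfl fun m hm => ?_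
  have hm : m ≤ n := by simpa [Nat.lt_succ_iff] using hm
  rw [show n + 1 - 1 - m = n - m by omega, coeff_egf_zero_pow_mul_U hm]

theorem coeff_U_sq_eq {n : ℕ} (hn : 1 ≤ n) :
    coeff n (U ^ 2) = (n : ℝ) ^ (n - 1) / n.factorial * (W n + 2 * n) := by
  obtain ⟨p, rfl⟩ : ∃ p, n = p + 1 := ⟨n - 1, by omega⟩
  rw [coeff_U_sq, Finset.sum_range_succ, Finset.sum_range_succ, W]
  simp only [Nat.add_sub_cancel]
  have h1 : ((p + 1).factorial : ℝ) = (p + 1) * p.factorial := by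
    rw [Nat.factorial_succ]; push_cast; ring
  have h2 : (p.factorial : ℝ) ≠ 0 := by positivity
  rw [h1]
  push_cast
  have h3 : (p : ℝ) + 1 ≠ 0 := by positivity
  field_simp
  ring

/-- Cayley's formula. -/
theorem powerSum_zero {n : ℕ} (hn : 1 ≤ n) : powerSum 0 n = (n : ℝ) ^ (n - 1) := by
  have h := congrArg (coeff n) euler_egf_zero_eq
  obtain ⟨p, rfl⟩ : ∃ p, n = p + 1 := ⟨n - 1, by omega⟩
  rw [coeff_euler, map_sub, coeff_U, coeff_egf, coeff_one, if_neg (by omega), sub_zero] at h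
  have h2 : ((p + 1).factorial : ℝ) ≠ 0 := by positivity
  have h3 : ((p + 1 : ℕ) : ℝ) ≠ 0 := by positivity
  rw [pow_succ] at h
  rw [Nat.add_sub_cancel]
  field_simp at h
  exact h

theorem powerSum_eq_factorial_mul (j n : ℕ) : powerSum j n = n.factorial * coeff n (egf j) := by
  rw [coeff_egf]
  have : (n.factorial : ℝ) ≠ 0 := by positivity
  field_simp

theorem powerSum_one {n : ℕ} (hn : 1 ≤ n) : powerSum 1 n = (n : ℝ) ^ (n - 1) * W n := by
  rw [powerSum_eq_factorial_mul, egf_one]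
  simp only [map_add, map_sub, map_nsmul, coeff_U_sq_eq hn, pow_one, coeff_U]
  simp only [nsmul_eq_mul]
  obtain ⟨p, rfl⟩ : ∃ p, n = p + 1 := ⟨n - 1, by omega⟩
  have h2 : ((p + 1).factorial : ℝ) ≠ 0 := by positivity
  rw [coeff_one, if_neg (by omega), Nat.add_sub_cancel, pow_succ]
  field_simp
  push_cast
  ring

/-- The powers of `U` are combinations of the `x d/dx`-iterates of `U` and `U ^ 2`, whose coefficients
are known; odd powers come from `U` and even powers from `U ^ 2`. -/
theorem powerSum_two {n : ℕ} (hn : 1 ≤ n) : powerSum 2 n =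
    (n : ℝ) ^ (n - 1) * (5 / 3 * (n : ℝ) ^ 3 - 5 / 3 * (n : ℝ) ^ 2 - 17 / 6 * n * W n) := by
  have h : (6 : ℕ) • egf 2 = 10 • euler (euler (U ^ 1)) - 17 • euler (U ^ 2)
      + 24 • euler (U ^ 1) := by
    simp only [euler_U_pow, map_sub, map_nsmul, egf_two]
    simp only [nsmul_eq_mul]
    push_cast
    ring
  have h' := congrArg (coeff n) h
  simp only [map_add, map_sub, map_nsmul, coeff_euler, coeff_U_sq_eq hn, pow_one, coeff_U] at h'
  simp only [nsmul_eq_mul] at h'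
  rw [powerSum_eq_factorial_mul]
  obtain ⟨p, rfl⟩ : ∃ p, n = p + 1 := ⟨n - 1, by omega⟩
  have h2 : ((p + 1).factorial : ℝ) ≠ 0 := by positivity
  rw [Nat.add_sub_cancel, pow_succ _ p] at h'
  field_simp at h'
  push_cast at h' ⊢
  linear_combination h' / 6

theorem powerSum_three {n : ℕ} (hn : 1 ≤ n) : powerSum 3 n =
    (n : ℝ) ^ (n - 1) * ((15 / 8 * (n : ℝ) ^ 3 + 157 / 24 * (n : ℝ) ^ 2 - 1 / 60 * n)
      * (W n + 2 * n) - 527 / 60 * (n : ℝ) ^ 4 - 481 / 60 * (n : ℝ) ^ 3) := by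
  have h : (120 : ℕ) • egf 3 = 225 • euler (euler (euler (U ^ 2)))
      - 1054 • euler (euler (euler (U ^ 1))) + 785 • euler (euler (U ^ 2))
      - 962 • euler (euler (U ^ 1)) - 2 • euler (U ^ 2) := by
    simp only [euler_U_pow, map_sub, map_nsmul, egf_three]
    simp only [nsmul_eq_mul]
    push_cast
    ring
  have h' := congrArg (coeff n) h
  simp only [map_add, map_sub, map_nsmul, coeff_euler, coeff_U_sq_eq hn, pow_one, coeff_U] at h'
  simp only [nsmul_eq_mul] at h'
  rw [powerSum_eq_factorial_mul]
  obtain ⟨p, rfl⟩ : ∃ p, n = p + 1 := ⟨n - 1, by omega⟩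
  have h2 : ((p + 1).factorial : ℝ) ≠ 0 := by positivity
  rw [Nat.add_sub_cancel, pow_succ _ p] at h'
  field_simp at h'
  push_cast at h' ⊢
  linear_combination h' / 120

end TreeSeries

/-! ### Asymptotics of `W` -/

namespace TreeSeries

/-- The probability that the first `j` of a sequence of independent uniform choices among `n`
objects are distinct. -/
noncomputable def birthday (n j : ℕ) : ℝ := n.descFactorial j / (n : ℝ) ^ j

theorem birthday_zero (n : ℕ) : birthday n 0 = 1 := by simp [birthday]

theorem birthday_one {n : ℕ} (hn : 1 ≤ n) : birthday n 1 = 1 := by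
  have h : (n : ℝ) ≠ 0 := by positivity
  rw [birthday, Nat.descFactorial_one, pow_one, div_self h]

theorem W_eq_birthday {n : ℕ} (hn : 1 ≤ n) :
    W n = n * (∑ j ∈ Finset.range (n + 1), birthday n j - 2) := by
  obtain ⟨p, rfl⟩ : ∃ p, n = p + 1 := ⟨n - 1, by omega⟩
  have h3 : ((p + 1 : ℕ) : ℝ) ≠ 0 := by positivity
  rw [Finset.sum_range_succ', Finset.sum_range_succ', W, Nat.add_sub_cancel]
  rw [birthday_zero, zero_add, birthday_one hn, add_assoc, one_add_one_eq_two, add_sub_cancel_right, Finset.mul_sum, Finset.mul_sum,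
    ← Finset.sum_range_reflect]
  refine Finset.sum_congr rfl fun k hk => ?_
  have hk : k < p := Finset.mem_range.1 hk
  have h := Nat.factorial_mul_descFactorial (show k + 1 + 1 ≤ p + 1 by omega)
  rw [show p + 1 - (k + 1 + 1) = p - 1 - k by omega] at h
  rw [← h, birthday]
  obtain ⟨q, rfl⟩ : ∃ q, p = k + 1 + q := ⟨p - (k + 1), by omega⟩
  rw [show k + 1 + q - 1 - k = q by omega]
  have hq : (q.factorial : ℝ) ≠ 0 := by positivity
  push_cast at h3 ⊢
  field_simp
  ring

theorem birthday_succ (n j : ℕ) (hj : j < n) : birthday n (j + 1) = birthday n j * (1 - j / n) := by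
  have hn : (n : ℝ) ≠ 0 := by
    have : 0 < n := by omega
    positivity
  rw [birthday, birthday, Nat.descFactorial_succ, pow_succ]
  push_cast [hj.le]
  field_simp

theorem birthday_nonneg (n j : ℕ) : 0 ≤ birthday n j := by unfold birthday; positivity

theorem birthday_succ_le {n j : ℕ} (hj : j < n) :
    birthday n (j + 1) ≤ Real.exp (-(1 / (2 * n)) * (j : ℝ) ^ 2) := by
  have hn : (0 : ℝ) < n := by exact_mod_cast (by omega : 0 < n)
  have h : ∀ j, j < n → birthday n (j + 1) ≤ Real.exp (-((j : ℝ) * (j + 1) / (2 * n))) := by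
    intro j
    induction j with
    | zero =>
      intro h
      rw [birthday_succ n 0 h]
      simp [birthday]
    | succ j ih =>
      intro h
      rw [birthday_succ n _ h]
      have h1 : (1 : ℝ) - (j + 1 : ℕ) / n ≤ Real.exp (-((j + 1 : ℕ) / n)) := by
        linarith [Real.add_one_le_exp (-((j + 1 : ℕ) / n : ℝ))]
      refine (mul_le_mul (ih (by omega)) h1 ?_ (Real.exp_pos _).le).trans ?_
      · rw [sub_nonneg, div_le_one hn]
        exact_mod_cast h.le
      · rw [← Real.exp_add]
        apply le_of_eq
        congr 1
        push_cast
        field_simp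
        ring
  refine (h j hj).trans (Real.exp_le_exp.2 ?_)
  rw [neg_mul, neg_le_neg_iff, one_div_mul_eq_div]
  gcongr
  nlinarith [Nat.cast_nonneg (α := ℝ) j]

/-- The factors `1 - i / n` with `i < j` exceed `exp (-i / (n - m))`, because
`1 / (1 - i / n) = 1 + i / (n - i) ≤ exp (i / (n - i))` and `i ≤ m`. -/
theorem le_birthday {n m j : ℕ} (hm : m < n) (hj : j ≤ m) :
    Real.exp (-(1 / (2 * ((n : ℝ) - m))) * (j : ℝ) ^ 2) ≤ birthday n j := by
  have hmn : (0 : ℝ) < (n : ℝ) - m := by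
    rw [sub_pos]; exact_mod_cast hm
  have hn : (0 : ℝ) < n := by exact_mod_cast (by omega : 0 < n)
  induction j with
  | zero => simp [birthday]
  | succ j ih =>
    rw [birthday_succ n j (by omega)]
    have hjn : (0 : ℝ) < 1 - j / n := by
      rw [sub_pos, div_lt_one hn]
      exact_mod_cast (by omega : j < n)
    have h1 : Real.exp (-(j / ((n : ℝ) - m))) ≤ 1 - j / n := by
      rw [Real.exp_neg, inv_le_comm₀ (Real.exp_pos _) hjn]
      refine le_trans ?_ (Real.add_one_le_exp _)
      have hj' : (j : ℝ) ≤ m := by exact_mod_cast (by omega : j ≤ m)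
      have hjn' : (0 : ℝ) < n - j := by linarith
      have : (1 - (j : ℝ) / n)⁻¹ = j / ((n : ℝ) - j) + 1 := by
        field_simp
        ring
      rw [this]
      gcongr
    refine le_trans ?_ (mul_le_mul (ih (by omega)) h1 (Real.exp_pos _).le (birthday_nonneg _ _))
    rw [← Real.exp_add, Real.exp_le_exp]
    push_cast
    rw [show -(1 / (2 * ((n : ℝ) - m))) * (j : ℝ) ^ 2 + -(j / ((n : ℝ) - m)) =
      -(1 / (2 * ((n : ℝ) - m))) * ((j : ℝ) ^ 2 + 2 * j) by field_simp; ring]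
    have : 0 < 1 / (2 * ((n : ℝ) - m)) := by positivity
    nlinarith

theorem antitoneOn_exp_neg_mul_sq {b : ℝ} (hb : 0 ≤ b) :
    AntitoneOn (fun x : ℝ => Real.exp (-b * x ^ 2)) (Set.Ici 0) := by
  intro x hx y hy hxy
  have hx : 0 ≤ x := hx
  simp only [Real.exp_le_exp, neg_mul, neg_le_neg_iff]
  gcongr

theorem sum_birthday_le {n : ℕ} (hn : 1 ≤ n) :
    ∑ j ∈ Finset.range (n + 1), birthday n j ≤ 2 + √n * √(Real.pi / 2) := by
  obtain ⟨p, rfl⟩ : ∃ p, n = p + 1 := ⟨n - 1, by omega⟩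
  set n := p + 1
  have hn0 : (0 : ℝ) < n := by positivity
  set b : ℝ := 1 / (2 * n) with hb
  have hb0 : 0 < b := by positivity
  rw [Finset.sum_range_succ', Finset.sum_range_succ']
  rw [birthday_zero, zero_add, birthday_one hn, add_assoc, one_add_one_eq_two, add_comm]
  gcongr
  have h2 : ∑ j ∈ Finset.range p, birthday n (j + 1 + 1) ≤
      ∑ j ∈ Finset.range p, Real.exp (-b * (0 + ((j + 1 : ℕ) : ℝ)) ^ 2) := by
    refine Finset.sum_le_sum fun j hj => ?_
    rw [zero_add]
    exact birthday_succ_le (by have := Finset.mem_range.1 hj; omega)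
  have h3 := AntitoneOn.sum_le_integral (f := fun x : ℝ => Real.exp (-b * x ^ 2)) (x₀ := 0) (a := p)
    ((antitoneOn_exp_neg_mul_sq hb0.le).mono Set.Icc_subset_Ici_self)
  refine h2.trans (h3.trans ?_)
  rw [zero_add, intervalIntegral.integral_of_le (by positivity)]
  have h4 : ∫ x in Set.Ioc 0 (p : ℝ), Real.exp (-b * x ^ 2) ≤
      ∫ x in Set.Ioi 0, Real.exp (-b * x ^ 2) :=
    setIntegral_mono_set (integrable_exp_neg_mul_sq hb0).integrableOn
      (ae_of_all _ fun x => (Real.exp_pos _).le) Set.Ioc_subset_Ioi_self.eventuallyLE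
  refine h4.trans (le_of_eq ?_)
  rw [integral_gaussian_Ioi, ← Real.sqrt_mul hn0.le,
    show Real.pi / b = 2 ^ 2 * (n * (Real.pi / 2)) by rw [hb]; field_simp,
    Real.sqrt_mul (by positivity), Real.sqrt_sq (by norm_num)]
  ring

/-- The sum over `j ≤ m` compared with an integral, substituted to have an integrand independent of
`n` and `m`. -/
theorem le_sum_birthday {n m : ℕ} (hm : m < n) :
    √((n : ℝ) - m) * ∫ y in (0 : ℝ)..(m / √((n : ℝ) - m)), Real.exp (-(1 / 2) * y ^ 2) ≤
      ∑ j ∈ Finset.range (n + 1), birthday n j := by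
  have hmn : (0 : ℝ) < (n : ℝ) - m := by
    rw [sub_pos]; exact_mod_cast hm
  have hs : 0 < √((n : ℝ) - m) := Real.sqrt_pos.2 hmn
  set b : ℝ := 1 / (2 * ((n : ℝ) - m)) with hb
  have hb0 : 0 < b := by positivity
  have h1 := AntitoneOn.integral_le_sum (f := fun x : ℝ => Real.exp (-b * x ^ 2)) (x₀ := 0) (a := m)
    ((antitoneOn_exp_neg_mul_sq hb0.le).mono Set.Icc_subset_Ici_self)
  have h2 := intervalIntegral.integral_comp_div (a := 0) (b := m)
    (fun y : ℝ => Real.exp (-(1 / 2) * y ^ 2)) hs.ne'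
  rw [zero_div, smul_eq_mul] at h2
  rw [← h2]
  have h3 : ∀ x : ℝ, -(1 / 2) * (x / √((n : ℝ) - m)) ^ 2 = -b * x ^ 2 := fun x => by
    rw [div_pow, Real.sq_sqrt hmn.le, hb]
    field_simp
  simp only [h3]
  rw [zero_add] at h1
  refine h1.trans ?_
  have h4 : ∑ j ∈ Finset.range m, Real.exp (-b * (0 + (j : ℝ)) ^ 2) ≤
      ∑ j ∈ Finset.range m, birthday n j := by
    refine Finset.sum_le_sum fun j hj => ?_
    rw [zero_add]
    exact le_birthday hm (Finset.mem_range.1 hj).le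
  refine h4.trans (Finset.sum_le_sum_of_subset_of_nonneg ?_ fun j _ _ => birthday_nonneg n j)
  exact Finset.range_subset_range.2 (by omega)

/-- The expected number of draws up to the first repetition is of order `√(π n / 2)`. In the lower bound
the sum is cut at `n ^ (3/4)`, which is negligible against `n` but not against `√n`. -/
theorem tendsto_sum_birthday :
    Tendsto (fun n : ℕ => (∑ j ∈ Finset.range (n + 1), birthday n j) / √n) atTop
      (𝓝 √(Real.pi / 2)) := by
  have hG : Tendsto (fun t : ℝ => ∫ y in (0 : ℝ)..t, Real.exp (-(1 / 2) * y ^ 2)) atTop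
      (𝓝 √(Real.pi / 2)) := by
    have h := intervalIntegral_tendsto_integral_Ioi 0
      (integrable_exp_neg_mul_sq (b := 1 / 2) (by norm_num)).integrableOn (tendsto_id (α := ℝ))
    rw [integral_gaussian_Ioi, show Real.pi / (1 / 2) = 2 ^ 2 * (Real.pi / 2) by ring,
      Real.sqrt_mul (by positivity), Real.sqrt_sq (by norm_num),
      mul_div_cancel_left₀ _ (two_ne_zero' ℝ)] at h
    exact h
  have hr : Tendsto (fun n : ℕ => (n : ℝ) ^ (1 / 4 : ℝ)) atTop atTop :=
    (tendsto_rpow_atTop (by norm_num)).comp tendsto_natCast_atTop_atTop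
  have hlow : Tendsto (fun n : ℕ => √(1 - ((n : ℝ) ^ (1 / 4 : ℝ))⁻¹) *
      ∫ y in (0 : ℝ)..((n : ℝ) ^ (1 / 4 : ℝ) - 1), Real.exp (-(1 / 2) * y ^ 2)) atTop
      (𝓝 √(Real.pi / 2)) := by
    have h1 : Tendsto (fun n : ℕ => √(1 - ((n : ℝ) ^ (1 / 4 : ℝ))⁻¹)) atTop (𝓝 1) := by
      have := (tendsto_const_nhds (x := (1 : ℝ))).sub (tendsto_inv_atTop_zero.comp hr)
      simpa using this.sqrt
    have h2 := hG.comp (tendsto_atTop_add_const_right _ (-1) hr)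
    simpa [sub_eq_add_neg] using h1.mul h2
  have hup : Tendsto (fun n : ℕ => 2 / √(n : ℝ) + √(Real.pi / 2)) atTop (𝓝 √(Real.pi / 2)) := by
    have h : Tendsto (fun n : ℕ => √(n : ℝ)) atTop atTop :=
      Real.tendsto_sqrt_atTop.comp tendsto_natCast_atTop_atTop
    simpa using (h.const_div_atTop 2).add_const √(Real.pi / 2)
  refine tendsto_of_tendsto_of_tendsto_of_le_of_le' hlow hup ?_ ?_
  · filter_upwards [eventually_ge_atTop 2] with n hn
    have hn0 : (0 : ℝ) < n := by positivity
    have hs : 0 < √(n : ℝ) := Real.sqrt_pos.2 hn0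
    -- with `r = n ^ (1/4)`: `n = r ^ 4`, `√n = r ^ 2`, and the sum is cut at `m = ⌊r ^ 3⌋`
    set r : ℝ := (n : ℝ) ^ (1 / 4 : ℝ) with hrdef
    have hr1 : 1 < r := Real.one_lt_rpow (by exact_mod_cast hn) (by norm_num)
    have hr4 : r ^ 4 = n := by
      rw [hrdef, ← Real.rpow_natCast, ← Real.rpow_mul hn0.le]
      norm_num
    have hr2 : √(n : ℝ) = r ^ 2 := by
      rw [← hr4, show r ^ 4 = (r ^ 2) ^ 2 by ring, Real.sqrt_sq (by positivity)]
    have hfl : (⌊r ^ 3⌋₊ : ℝ) ≤ r ^ 3 := Nat.floor_le (by positivity)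
    have hfl' : r ^ 3 < ⌊r ^ 3⌋₊ + 1 := Nat.lt_floor_add_one _
    set m := ⌊r ^ 3⌋₊
    have hr34 : r ^ 3 < r ^ 4 := pow_lt_pow_right₀ hr1 (by norm_num)
    have hmn : (m : ℝ) < n := by rw [← hr4]; linarith
    have hm : m < n := by exact_mod_cast hmn
    have hs' : 0 < √((n : ℝ) - m) := Real.sqrt_pos.2 (by linarith)
    rw [le_div_iff₀ hs]
    refine le_trans ?_ (le_sum_birthday hm)
    rw [mul_right_comm, ← Real.sqrt_mul (sub_nonneg.2 (inv_le_one_of_one_le₀ hr1.le))]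
    have e1 : (1 - r⁻¹) * (n : ℝ) ≤ n - m := by
      rw [sub_mul, one_mul, ← hr4, show r⁻¹ * r ^ 4 = r ^ 3 by field_simp]
      linarith
    have e2 : r - 1 ≤ m / √((n : ℝ) - m) := by
      rw [le_div_iff₀ hs']
      have : √((n : ℝ) - m) ≤ r ^ 2 := by
        rw [← hr2]
        exact Real.sqrt_le_sqrt (by linarith [Nat.cast_nonneg (α := ℝ) m])
      nlinarith
    gcongr
    · exact intervalIntegral.integral_nonneg (by linarith) fun x _ => (Real.exp_pos _).le
    · refine intervalIntegral.integral_mono_interval le_rfl (by linarith) e2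
        (ae_of_all _ fun x => (Real.exp_pos _).le) ?_
      exact (integrable_exp_neg_mul_sq (by norm_num)).intervalIntegrable
  · filter_upwards [eventually_ge_atTop 1] with n hn
    have hn0 : (0 : ℝ) < n := by positivity
    have hs : 0 < √(n : ℝ) := Real.sqrt_pos.2 hn0
    rw [div_le_iff₀ hs, add_mul, div_mul_cancel₀ _ hs.ne', mul_comm √(Real.pi / 2)]
    exact sum_birthday_le hn

theorem tendsto_W_div : Tendsto (fun n : ℕ => W n / √(n : ℝ) ^ 3) atTop (𝓝 √(Real.pi / 2)) := by
  have h : Tendsto (fun n : ℕ => √(n : ℝ)) atTop atTop :=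
    Real.tendsto_sqrt_atTop.comp tendsto_natCast_atTop_atTop
  have h2 := tendsto_sum_birthday.sub (h.const_div_atTop 2)
  rw [sub_zero] at h2
  refine h2.congr' ?_
  filter_upwards [eventually_ge_atTop 1] with n hn
  have hn0 : (0 : ℝ) < n := by positivity
  have hs : 0 < √(n : ℝ) := Real.sqrt_pos.2 hn0
  rw [W_eq_birthday hn, ← sub_div, div_eq_div_iff hs.ne' (by positivity)]
  linear_combination (∑ j ∈ Finset.range (n + 1), birthday n j - 2) * √(n : ℝ) *
    Real.sq_sqrt hn0.le

end TreeSeries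

/-! ### Moments of the total height -/

namespace TreeSeries

open RootedLabeledTree

instance {n : ℕ} : IsFiniteMeasure (uniform n) := by
  unfold uniform; infer_instance

theorem integral_uniform {n : ℕ} (hn : 1 ≤ n) (f : RootedLabeledTree n → ℝ) :
    ∫ T, f T ∂(uniform n) = (∑ T, f T) / (n : ℝ) ^ (n - 1) := by
  have hc : (Fintype.card (RootedLabeledTree n) : ℝ) = (n : ℝ) ^ (n - 1) := by
    rw [← powerSum_zero hn]
    simp [powerSum]
  rw [integral_fintype .of_finite, Finset.sum_div]
  refine Finset.sum_congr rfl fun T _ => ?_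
  rw [uniform, Measure.real, uniformOn_univ, Measure.count_singleton, smul_eq_mul, ← hc]
  simp [div_eq_inv_mul]

theorem integral_X {n : ℕ} (hn : 1 ≤ n) : ∫ T, X n T ∂(uniform n) = W n := by
  have h : ∑ T, X n T = powerSum 1 n := by simp [X, powerSum]
  have h0 : (n : ℝ) ≠ 0 := by positivity
  rw [integral_uniform hn, h, powerSum_one hn]
  field_simp

theorem variance_X {n : ℕ} (hn : 1 ≤ n) : variance (X n) (uniform n) =
    5 / 3 * (n : ℝ) ^ 3 - 5 / 3 * (n : ℝ) ^ 2 - 17 / 6 * n * W n - W n ^ 2 := by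
  have h : ∑ T, (X n T - W n) ^ 2 =
      powerSum 2 n - 2 * W n * powerSum 1 n + W n ^ 2 * powerSum 0 n := by
    simp only [X, powerSum, Finset.mul_sum, ← Finset.sum_add_distrib, ← Finset.sum_sub_distrib]
    exact Finset.sum_congr rfl fun T _ => by ring
  have h0 : (n : ℝ) ≠ 0 := by positivity
  rw [variance_eq_integral Measurable.of_discrete.aemeasurable, integral_X hn, integral_uniform hn,
    h, powerSum_zero hn, powerSum_one hn, powerSum_two hn]
  field_simp
  ring

theorem centralMoment_X {n : ℕ} (hn : 1 ≤ n) : centralMoment (X n) 3 (uniform n) =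
    2 * W n ^ 3 + 17 / 2 * (n : ℝ) * W n ^ 2
      + (-(25 / 8) * (n : ℝ) ^ 3 + 277 / 24 * (n : ℝ) ^ 2 - 1 / 60 * (n : ℝ)) * W n
      - 151 / 30 * (n : ℝ) ^ 4 + 76 / 15 * (n : ℝ) ^ 3 - 1 / 30 * (n : ℝ) ^ 2 := by
  have h : ∑ T, (X n T - W n) ^ 3 = powerSum 3 n - 3 * W n * powerSum 2 n
      + 3 * W n ^ 2 * powerSum 1 n - W n ^ 3 * powerSum 0 n := by
    simp only [X, powerSum, Finset.mul_sum, ← Finset.sum_add_distrib, ← Finset.sum_sub_distrib]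
    exact Finset.sum_congr rfl fun T _ => by ring
  have h0 : (n : ℝ) ≠ 0 := by positivity
  have h' : centralMoment (X n) 3 (uniform n) = ∫ T, (X n T - W n) ^ 3 ∂(uniform n) := by
    rw [centralMoment, integral_X hn]
    rfl
  rw [h', integral_uniform hn, h, powerSum_zero hn, powerSum_one hn, powerSum_two hn,
    powerSum_three hn]
  field_simp
  ring

/-! ### Limits of the moments -/

theorem tendsto_sqrt_natCast_inv : Tendsto (fun n : ℕ => (√(n : ℝ))⁻¹) atTop (𝓝 0) :=
  tendsto_inv_atTop_zero.comp (Real.tendsto_sqrt_atTop.comp tendsto_natCast_atTop_atTop)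

theorem tendsto_variance_X :
    Tendsto (fun n : ℕ => variance (X n) (uniform n) / √(n : ℝ) ^ 6) atTop
      (𝓝 ((10 - 3 * Real.pi) / 6)) := by
  have hw := tendsto_W_div
  have hi := tendsto_sqrt_natCast_inv
  have h := ((tendsto_const_nhds (x := (5 / 3 : ℝ))).sub ((hi.pow 2).const_mul (5 / 3))).sub
    ((hi.mul hw).const_mul (17 / 6)) |>.sub (hw.pow 2)
  have e : (5 / 3 : ℝ) - 5 / 3 * 0 ^ 2 - 17 / 6 * (0 * √(Real.pi / 2)) - √(Real.pi / 2) ^ 2 =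
      (10 - 3 * Real.pi) / 6 := by
    rw [Real.sq_sqrt (by positivity)]; ring
  rw [e] at h
  refine h.congr' ?_
  filter_upwards [eventually_ge_atTop 1] with n hn
  have hs : 0 < √(n : ℝ) := Real.sqrt_pos.2 (by positivity)
  have hsq : (n : ℝ) = √(n : ℝ) ^ 2 := (Real.sq_sqrt (by positivity)).symm
  rw [variance_X hn]
  generalize √(n : ℝ) = s at *
  rw [hsq]
  field_simp

theorem tendsto_centralMoment_X :
    Tendsto (fun n : ℕ => centralMoment (X n) 3 (uniform n) / √(n : ℝ) ^ 9) atTop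
      (𝓝 (√(Real.pi / 2) * (Real.pi - 25 / 8))) := by
  have hw := tendsto_W_div
  have hi := tendsto_sqrt_natCast_inv
  have h := ((hw.pow 3).const_mul 2).add ((hi.mul (hw.pow 2)).const_mul (17 / 2))
    |>.add (hw.const_mul (-(25 / 8))) |>.add (((hi.pow 2).mul hw).const_mul (277 / 24))
    |>.sub (((hi.pow 4).mul hw).const_mul (1 / 60)) |>.sub (hi.const_mul (151 / 30))
    |>.add ((hi.pow 3).const_mul (76 / 15)) |>.sub ((hi.pow 5).const_mul (1 / 30))
  have e : 2 * √(Real.pi / 2) ^ 3 + 17 / 2 * (0 * √(Real.pi / 2) ^ 2)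
      + -(25 / 8) * √(Real.pi / 2) + 277 / 24 * (0 ^ 2 * √(Real.pi / 2))
      - 1 / 60 * (0 ^ 4 * √(Real.pi / 2)) - 151 / 30 * 0 + 76 / 15 * 0 ^ 3 - 1 / 30 * 0 ^ 5 =
      √(Real.pi / 2) * (Real.pi - 25 / 8) := by
    linear_combination 2 * √(Real.pi / 2) * Real.sq_sqrt (show 0 ≤ Real.pi / 2 by positivity)
  rw [e] at h
  refine h.congr' ?_
  filter_upwards [eventually_ge_atTop 1] with n hn
  have hs : 0 < √(n : ℝ) := Real.sqrt_pos.2 (by positivity)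
  have hsq : (n : ℝ) = √(n : ℝ) ^ 2 := (Real.sq_sqrt (by positivity)).symm
  rw [centralMoment_X hn]
  generalize √(n : ℝ) = s at *
  rw [hsq]
  field_simp
  ring

/-! ### The constants -/

theorem pi_mem : (3.14159265358979323846 : ℝ) < Real.pi ∧ Real.pi < 3.14159265358979323847 :=
  ⟨Real.pi_gt_d20, Real.pi_lt_d20⟩

theorem sqrt_two_mul_sqrt_pi : √2 * √Real.pi = 2 * √(Real.pi / 2) := by
  rw [← Real.sqrt_mul (by norm_num), show 2 * Real.pi = 2 ^ 2 * (Real.pi / 2) by ring,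
    Real.sqrt_mul (by norm_num), Real.sqrt_sq (by norm_num)]

theorem pi_rpow : Real.pi ^ (3 / 2 : ℝ) = Real.pi * √Real.pi := by
  rw [Real.sqrt_eq_rpow, show (3 / 2 : ℝ) = 1 + 1 / 2 by norm_num,
    Real.rpow_add Real.pi_pos, Real.rpow_one]

theorem third_moment_constant :
    1 / 2 * √2 * Real.pi ^ (3 / 2 : ℝ) - 25 / 16 * √2 * √Real.pi =
      √(Real.pi / 2) * (Real.pi - 25 / 8) := by
  rw [pi_rpow]
  linear_combination (Real.pi / 2 - 25 / 16) * sqrt_two_mul_sqrt_pi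

theorem third_moment_constant_approx :
    |√(Real.pi / 2) * (Real.pi - 25 / 8) - 0.020795808| < (1e-9 : ℝ) := by
  obtain ⟨h1, h2⟩ := pi_mem
  have l : 1.2533141373 ≤ √(Real.pi / 2) := Real.le_sqrt_of_sq_le (by norm_num at h1 ⊢; linarith)
  have u : √(Real.pi / 2) ≤ 1.2533141374 := (Real.sqrt_le_left (by norm_num)).2
    (by norm_num at h2 ⊢; linarith)
  rw [abs_lt]
  constructor <;> norm_num at * <;> nlinarith

theorem skewness_constant :
    √(Real.pi / 2) * (Real.pi - 25 / 8) / √((10 - 3 * Real.pi) / 6) ^ 3 =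
      (6 * Real.pi - 75 / 4) * √3 * √(Real.pi / (10 - 3 * Real.pi)) / (10 - 3 * Real.pi) := by
  obtain ⟨h1, h2⟩ := pi_mem
  have hd : 0 < 10 - 3 * Real.pi := by norm_num at h2; linarith
  generalize 10 - 3 * Real.pi = d at hd ⊢
  have e1 : √(Real.pi / 2) = √3 * √(Real.pi / d) * √(d / 6) := by
    rw [← Real.sqrt_mul (by norm_num), ← Real.sqrt_mul (by positivity)]
    congr 1
    field_simp
    norm_num
  have e2 := Real.sq_sqrt (show 0 ≤ d / 6 by positivity)
  have e3 : 0 < √(d / 6) := Real.sqrt_pos.2 (by positivity)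
  rw [e1, pow_succ, e2]
  generalize √(d / 6) = t at e3 ⊢
  generalize √(Real.pi / d) = q
  field_simp
  ring

theorem skewness_constant_approx :
    |(6 * Real.pi - 75 / 4) * √3 * √(Real.pi / (10 - 3 * Real.pi)) / (10 - 3 * Real.pi)
        - 0.7005665| < (5e-8 : ℝ) := by
  obtain ⟨h1, h2⟩ := pi_mem
  norm_num at h1 h2
  have hd : 0 < 10 - 3 * Real.pi := by linarith
  rw [mul_assoc, ← Real.sqrt_mul (by norm_num)]
  have l : 4.0477884 ≤ √(3 * (Real.pi / (10 - 3 * Real.pi))) := Real.le_sqrt_of_sq_le (by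
    rw [← mul_div_assoc, le_div_iff₀ hd]; norm_num; linarith)
  have u : √(3 * (Real.pi / (10 - 3 * Real.pi))) ≤ 4.0477885 := (Real.sqrt_le_left (by norm_num)).2
    (by rw [← mul_div_assoc, div_le_iff₀ hd]; norm_num; linarith)
  rw [abs_sub_lt_iff, sub_lt_iff_lt_add, sub_lt_comm, div_lt_iff₀ hd, lt_div_iff₀ hd]
  norm_num at l u
  constructor <;> norm_num <;> nlinarith

theorem third_moment_constant_pos : 0 < √(Real.pi / 2) * (Real.pi - 25 / 8) := by
  have h := pi_mem.1
  norm_num at h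
  have : 0 < Real.pi - 25 / 8 := by linarith
  positivity

theorem variance_constant_pos : 0 < (10 - 3 * Real.pi) / 6 := by
  have h := pi_mem.2
  norm_num at h
  linarith

/-! ### Third moment and skewness -/

theorem isEquivalent_centralMoment_X :
    (fun n : ℕ => centralMoment (X n) 3 (uniform n)) ~[atTop]
      (fun n : ℕ => √(Real.pi / 2) * (Real.pi - 25 / 8) * (n : ℝ) ^ (9 / 2 : ℝ)) := by
  apply isEquivalent_of_tendsto_one
  have h := tendsto_centralMoment_X.div_const (√(Real.pi / 2) * (Real.pi - 25 / 8))
  rw [div_self third_moment_constant_pos.ne'] at h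
  refine h.congr fun n => ?_
  have e : (n : ℝ) ^ (9 / 2 : ℝ) = √(n : ℝ) ^ 9 := by
    rw [Real.sqrt_eq_rpow, ← Real.rpow_natCast, ← Real.rpow_mul (by positivity)]
    norm_num
  rw [Pi.div_apply, e, div_div, mul_comm (√(n : ℝ) ^ 9)]

theorem tendsto_skewness_X :
    Tendsto (fun n : ℕ => skewness (X n) (uniform n)) atTop
      (𝓝 (√(Real.pi / 2) * (Real.pi - 25 / 8) / √((10 - 3 * Real.pi) / 6) ^ 3)) := by
  have h := tendsto_centralMoment_X.div (tendsto_variance_X.sqrt.pow 3)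
    (by have := Real.sqrt_pos.2 variance_constant_pos; positivity)
  refine h.congr' ?_
  filter_upwards [eventually_ge_atTop 1] with n hn
  have hs : 0 < √(n : ℝ) := Real.sqrt_pos.2 (by positivity)
  simp only [Pi.div_apply]
  rw [skewness, show √(n : ℝ) ^ 6 = (√(n : ℝ) ^ 3) ^ 2 by ring,
    Real.sqrt_div' _ (by positivity), Real.sqrt_sq (by positivity)]
  field_simp

/-! ### The limit distribution is not normal -/

/-- The distance from the mean to the minimal conceivable value `0`, in standard deviations, stays
bounded. -/
theorem tendsto_mean_div_deviation :
    Tendsto (fun n : ℕ => W n / √(variance (X n) (uniform n))) atTop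
      (𝓝 (√(Real.pi / 2) / √((10 - 3 * Real.pi) / 6))) := by
  have h := tendsto_W_div.div tendsto_variance_X.sqrt
    (Real.sqrt_pos.2 variance_constant_pos).ne'
  refine h.congr' ?_
  filter_upwards [eventually_ge_atTop 1] with n hn
  have hs : 0 < √(n : ℝ) := Real.sqrt_pos.2 (by positivity)
  simp only [Pi.div_apply]
  rw [show √(n : ℝ) ^ 6 = (√(n : ℝ) ^ 3) ^ 2 by ring,
    Real.sqrt_div' _ (by positivity), Real.sqrt_sq (by positivity)]
  field_simp

theorem eventually_variance_X_pos : ∀ᶠ n : ℕ in atTop, 0 < variance (X n) (uniform n) := by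
  filter_upwards [tendsto_variance_X.eventually_const_lt variance_constant_pos,
    eventually_ge_atTop 1] with n h hn
  have hs : 0 < √(n : ℝ) := Real.sqrt_pos.2 (by positivity)
  by_contra h'
  exact absurd h (not_lt.2 (div_nonpos_of_nonpos_of_nonneg (not_lt.1 h') (by positivity)))

theorem neg_le_standardize {n : ℕ} (hn : 1 ≤ n) (T : RootedLabeledTree n) :
    -(W n / √(variance (X n) (uniform n))) ≤ standardize (X n) (uniform n) T := by
  rw [standardize, integral_X hn, ← neg_div]
  gcongr
  have : 0 ≤ X n T := Nat.cast_nonneg _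
  linarith

/-- A standardized random variable that is bounded from below, with bounded skewness, is not
concentrated near any point `m`: the third absolute moment controls the loss in truncating
`(Z - m) ^ 2`. -/
theorem le_integral_min_sq {Ω : Type*} [MeasurableSpace Ω] {μ : Measure Ω} [IsProbabilityMeasure μ]
    {Z : Ω → ℝ} {C K A : ℝ} (m : ℝ) (i1 : Integrable Z μ) (i2 : Integrable (fun ω => Z ω ^ 2) μ)
    (i3 : Integrable (fun ω => Z ω ^ 3) μ)
    (i4 : Integrable (fun ω => min ((Z ω - m) ^ 2) (A ^ 2)) μ) (h1 : ∫ ω, Z ω ∂μ = 0)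
    (h2 : ∫ ω, Z ω ^ 2 ∂μ = 1) (h3 : ∫ ω, Z ω ^ 3 ∂μ ≤ K) (hC : 0 ≤ C) (hZ : ∀ ω, -C ≤ Z ω)
    (hA : 0 < A) :
    1 + m ^ 2 - 4 * (K + 2 * C ^ 3 + |m| ^ 3) / A ≤ ∫ ω, min ((Z ω - m) ^ 2) (A ^ 2) ∂μ := by
  have hp : ∀ z : ℝ, -C ≤ z →
      z ^ 2 - 2 * m * z + m ^ 2 - 4 / A * (z ^ 3 + 2 * C ^ 3 + |m| ^ 3) ≤
        min ((z - m) ^ 2) (A ^ 2) := by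
    intro z hz
    have a1 : |z| ^ 3 ≤ z ^ 3 + 2 * C ^ 3 := by
      rcases le_total 0 z with h | h
      · rw [abs_of_nonneg h]
        have : 0 ≤ C ^ 3 := by positivity
        linarith
      · rw [abs_of_nonpos h]
        have : (-z) ^ 3 ≤ C ^ 3 := pow_le_pow_left₀ (by linarith) (by linarith) 3
        nlinarith
    have a2 : |z - m| ^ 3 ≤ 4 * (|z| ^ 3 + |m| ^ 3) := by
      have b1 : |z - m| ≤ |z| + |m| := abs_sub _ _
      have b2 := pow_le_pow_left₀ (abs_nonneg _) b1 3
      have := abs_nonneg z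
      have := abs_nonneg m
      nlinarith [mul_nonneg (add_nonneg (abs_nonneg z) (abs_nonneg m)) (sq_nonneg (|z| - |m|))]
    have a3 : (z - m) ^ 2 - |z - m| ^ 3 / A ≤ min ((z - m) ^ 2) (A ^ 2) := by
      refine le_min (sub_le_self _ (by positivity)) ?_
      rw [← sq_abs (z - m)]
      have := abs_nonneg (z - m)
      generalize |z - m| = t at *
      rcases le_total t A with h | h
      · have : t ^ 2 ≤ A ^ 2 := by gcongr
        have : 0 ≤ t ^ 3 / A := by positivity
        linarith
      · have : t ^ 2 ≤ t ^ 3 / A := by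
          rw [le_div_iff₀ hA, pow_succ t 2]
          gcongr
        have : 0 ≤ A ^ 2 := by positivity
        linarith
    refine le_trans ?_ a3
    have a4 : |z - m| ^ 3 / A ≤ 4 / A * (z ^ 3 + 2 * C ^ 3 + |m| ^ 3) := by
      rw [div_mul_eq_mul_div]
      gcongr
      linarith
    linarith
  have j1 : Integrable (fun ω => Z ω ^ 2 - 2 * m * Z ω) μ := i2.sub (i1.const_mul _)
  have j2 : Integrable (fun ω => Z ω ^ 2 - 2 * m * Z ω + m ^ 2) μ := j1.add (integrable_const _)
  have j3 : Integrable (fun ω => Z ω ^ 3 + 2 * C ^ 3) μ := i3.add (integrable_const _)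
  have j4 : Integrable (fun ω => 4 / A * (Z ω ^ 3 + 2 * C ^ 3 + |m| ^ 3)) μ :=
    (j3.add (integrable_const _)).const_mul _
  have hle := integral_mono (j2.sub j4) i4 fun ω => hp _ (hZ ω)
  have hi : ∫ ω, (Z ω ^ 2 - 2 * m * Z ω + m ^ 2 - 4 / A * (Z ω ^ 3 + 2 * C ^ 3 + |m| ^ 3)) ∂μ =
      1 + m ^ 2 - 4 / A * (∫ ω, Z ω ^ 3 ∂μ + 2 * C ^ 3 + |m| ^ 3) := by
    rw [integral_sub j2 j4, integral_add j1 (integrable_const _),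
      integral_sub i2 (i1.const_mul _), integral_const_mul, integral_const_mul,
      integral_add j3 (integrable_const _), integral_add i3 (integrable_const _), h1, h2]
    simp
  change ∫ ω, (Z ω ^ 2 - 2 * m * Z ω + m ^ 2 - 4 / A * (Z ω ^ 3 + 2 * C ^ 3 + |m| ^ 3)) ∂μ ≤ _
    at hle
  rw [hi] at hle
  refine le_trans ?_ hle
  rw [← div_mul_eq_mul_div]
  gcongr

theorem integral_standardize {Ω : Type*} [MeasurableSpace Ω] {μ : Measure Ω}
    [IsProbabilityMeasure μ] {Y : Ω → ℝ} (hY : Integrable Y μ) :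
    ∫ ω, standardize Y μ ω ∂μ = 0 := by
  simp only [standardize]
  rw [integral_div, integral_sub hY (integrable_const _)]
  simp

theorem integral_standardize_sq {Ω : Type*} [MeasurableSpace Ω] {μ : Measure Ω}
    {Y : Ω → ℝ} (hY : AEMeasurable Y μ) (hv : 0 < variance Y μ) :
    ∫ ω, standardize Y μ ω ^ 2 ∂μ = 1 := by
  simp only [standardize, div_pow]
  rw [integral_div, ← variance_eq_integral hY, Real.sq_sqrt hv.le, div_self hv.ne']

theorem integral_standardize_cube {Ω : Type*} [MeasurableSpace Ω] {μ : Measure Ω}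
    (Y : Ω → ℝ) : ∫ ω, standardize Y μ ω ^ 3 ∂μ = skewness Y μ := by
  simp only [standardize, div_pow]
  rw [integral_div]
  rfl

/-- A continuous bounded version of `(x - m) ^ 2`. -/
noncomputable def truncatedSq (m A : ℝ) : BoundedContinuousFunction ℝ ℝ :=
  BoundedContinuousFunction.ofNormedAddCommGroup (fun x => min ((x - m) ^ 2) (A ^ 2))
    (by fun_prop) (A ^ 2) fun x => by
      rw [Real.norm_of_nonneg (le_min (sq_nonneg _) (sq_nonneg _))]
      exact min_le_right _ _

/-- The standardized total height is eventually at least `-C`, so a limit law lives on `[-C, ∞)`. This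
excludes the normal laws of positive variance. A point mass at `m` is excluded by the test function
`truncatedSq m A`, which vanishes at `m` while its expectations stay at least `1 / 2`. -/
theorem not_tendstoInDistribution_standardize_X (φ : ℕ → ℕ) (hφ : StrictMono φ) (m : ℝ)
    (v : NNReal) : ¬ TendstoInDistribution
      (fun k : ℕ => standardize (X (φ k + 1)) (uniform (φ k + 1))) atTop
      (id : ℝ → ℝ) (fun k : ℕ => uniform (φ k + 1)) (gaussianReal m v) := by
  intro h
  have hφ' : Tendsto (fun k => φ k + 1) atTop atTop :=
    (tendsto_add_atTop_nat 1).comp hφ.tendsto_atTop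
  set L := √(Real.pi / 2) / √((10 - 3 * Real.pi) / 6)
  set C := L + 1
  have hL : 0 ≤ L := by positivity
  have hlow : ∀ᶠ k in atTop, ∀ T, -C ≤ standardize (X (φ k + 1)) (uniform (φ k + 1)) T := by
    filter_upwards [hφ'.eventually
      (tendsto_mean_div_deviation.eventually_lt_const (lt_add_one L))] with k hk T
    exact (neg_le_neg hk.le).trans (neg_le_standardize (by omega) T)
  have ht := h.tendsto
  by_cases hv : v = 0
  · subst hv
    set K := √(Real.pi / 2) * (Real.pi - 25 / 8) / √((10 - 3 * Real.pi) / 6) ^ 3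
    have hK : 0 < K := div_pos third_moment_constant_pos
      (pow_pos (Real.sqrt_pos.2 variance_constant_pos) 3)
    -- chosen to make the lower bound in `le_integral_min_sq` at least `1 - 1 / 2`
    set A := 8 * (K + 1 + 2 * C ^ 3 + |m| ^ 3)
    have hA : 0 < A := by positivity
    have h1 := (ProbabilityMeasure.tendsto_iff_forall_integral_tendsto.1 ht) (truncatedSq m A)
    simp only [ProbabilityMeasure.coe_mk, Measure.map_id, gaussianReal_zero_var,
      integral_dirac] at h1
    have h0 : truncatedSq m A m = 0 := by
      change min ((m - m) ^ 2) (A ^ 2) = 0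
      rw [sub_self, zero_pow two_ne_zero, min_eq_left (sq_nonneg A)]
    rw [h0] at h1
    have h2 : ∀ᶠ k in atTop, (1 / 2 : ℝ) ≤ ∫ x, truncatedSq m A x
        ∂((uniform (φ k + 1)).map (standardize (X (φ k + 1)) (uniform (φ k + 1)))) := by
      filter_upwards [hlow, hφ'.eventually eventually_variance_X_pos,
        hφ'.eventually (tendsto_skewness_X.eventually_lt_const (lt_add_one K))] with k k1 k2 k3
      rw [integral_map (Measurable.of_discrete.aemeasurable)
        (truncatedSq m A).continuous.aestronglyMeasurable]
      refine le_trans ?_ (le_integral_min_sq (C := C) (K := K + 1) (A := A) m .of_finite .of_finite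
        .of_finite .of_finite (integral_standardize .of_finite)
        (integral_standardize_sq Measurable.of_discrete.aemeasurable k2)
        ((integral_standardize_cube _).trans_le k3.le) (by positivity) k1 hA)
      have : 4 * (K + 1 + 2 * C ^ 3 + |m| ^ 3) / A = 1 / 2 := by
        rw [div_eq_iff hA.ne']
        simp only [A]
        ring
      rw [this]
      nlinarith [sq_nonneg m]
    have h3 := ge_of_tendsto h1 h2
    norm_num at h3
  · have h1 := ProbabilityMeasure.le_liminf_measure_open_of_tendsto ht (isOpen_Iio (a := -C))
    have h2 : ∀ᶠ k in atTop, ((uniform (φ k + 1)).map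
        (standardize (X (φ k + 1)) (uniform (φ k + 1)))) (Set.Iio (-C)) = 0 := by
      filter_upwards [hlow] with k hk
      rw [Measure.map_apply Measurable.of_discrete measurableSet_Iio]
      convert measure_empty (μ := uniform (φ k + 1))
      ext T
      simpa using hk T
    simp only [ProbabilityMeasure.coe_mk, Measure.map_id] at h1
    rw [liminf_congr h2, liminf_const] at h1
    have h3 := gaussianReal_absolutelyContinuous' m hv (le_antisymm h1 zero_le)
    simp at h3

end TreeSeries

open RootedLabeledTree in
theorem theorem3 :
    (∀ n : ℕ, 1 ≤ n →
      centralMoment (X n) 3 (uniform n) =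
        2 * W n ^ 3 + 17 / 2 * (n : ℝ) * W n ^ 2
          + (-(25 / 8) * (n : ℝ) ^ 3 + 277 / 24 * (n : ℝ) ^ 2 - 1 / 60 * (n : ℝ)) * W n
          - 151 / 30 * (n : ℝ) ^ 4 + 76 / 15 * (n : ℝ) ^ 3 - 1 / 30 * (n : ℝ) ^ 2) ∧
    ((fun n : ℕ => centralMoment (X n) 3 (uniform n)) ~[atTop]
      (fun n : ℕ => (1 / 2 * √2 * Real.pi ^ (3 / 2 : ℝ) - 25 / 16 * √2 * √Real.pi)
        * (n : ℝ) ^ (9 / 2 : ℝ))) ∧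
    |(1 / 2 * √2 * Real.pi ^ (3 / 2 : ℝ) - 25 / 16 * √2 * √Real.pi) - 0.020795808|
      < (1e-9 : ℝ) ∧
    Tendsto (fun n : ℕ => skewness (X n) (uniform n)) atTop
      (𝓝 ((6 * Real.pi - 75 / 4) * √3 * √(Real.pi / (10 - 3 * Real.pi)) / (10 - 3 * Real.pi))) ∧
    |(6 * Real.pi - 75 / 4) * √3 * √(Real.pi / (10 - 3 * Real.pi)) / (10 - 3 * Real.pi)
        - 0.7005665| < (5e-8 : ℝ) ∧
    (∀ φ : ℕ → ℕ, StrictMono φ → ∀ (m : ℝ) (v : NNReal),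
      ¬ TendstoInDistribution
          (fun k : ℕ => standardize (X (φ k + 1)) (uniform (φ k + 1))) atTop
          (id : ℝ → ℝ) (fun k : ℕ => uniform (φ k + 1)) (gaussianReal m v)) := by
  rw [TreeSeries.third_moment_constant]
  refine ⟨fun n hn => TreeSeries.centralMoment_X hn, TreeSeries.isEquivalent_centralMoment_X,
    TreeSeries.third_moment_constant_approx, ?_, TreeSeries.skewness_constant_approx,
    TreeSeries.not_tendstoInDistribution_standardize_X⟩
  rw [← TreeSeries.skewness_constant]
  exact TreeSeries.tendsto_skewness_X
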